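/- Let $\Gamma$ be a finite, simple, connected graph with vertex set $X$, path-length distance $\partial$ and diameter $D\ge 3$. Assume $\Gamma$ is distance-regular: for $0\le h,i,j\le D$ and vertices $y,z$ with $\partial(y,z)=h$, the number $p^h_{ij}=|\{u\in X:\partial(y,u)=i,\ \partial(z,u)=j\}|$ does not depend on the choice of $y,z$. Put $c_i=p^i_{1,i-1}$ $(1\le i\le D)$, $a_i=p^i_{1,i}$ $(0\le i\le D)$, $b_i=p^i_{1,i+1}$ $(0\le i\le D-1)$ and $k=p^0_{11}$. Assume that $\Gamma$ has classical parameters $(D,b,\alpha,\beta)$ with $b<-1$, that is, with $[j]=1+b+\cdots+b^{j-1}$, $c_i=[i]\,(1+\alpha[i-1])$ for $1\le i\le D$ and $b_i=([D]-[i])(\beta-\alpha[i])$ for $0\le i\le D-1$. Assume also that $a_1\neq 0$ and that $\Gamma$ is not a near polygon, where $\Gamma$ is called a near polygon if $a_i=a_1c_i$ for $1\le i\le D-1$ and there are no vertices $u,v,w,z$ with $u,v,w$ mutually adjacent, $\partial(u,z)=2$ and $\partial(v,z)=\partial(w,z)=1$. Fix $x\in X$. Let $V=\mathbb{C}^X$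 with the Hermitian inner product $\langle u,v\rangle=u^t\overline{v}$. Let $A_i$ $(0\le i\le D)$ be the distance matrices, $(A_i)_{yz}=1$ if $\partial(y,z)=i$ and $0$ otherwise, let $A=A_1$, and let $E_i^*$ $(0\le i\le D)$ be the diagonal matrix with $(E_i^*)_{yy}=1$ if $\partial(x,y)=i$ and $0$ otherwise. Let $T=T(x)$ be the subalgebra of $\mathrm{Mat}_X(\mathbb{C})$ generated by $A_0,\dots,A_D,E_0^*,\dots,E_D^*$ (the Terwilliger algebra). A $T$-module is a subspace $W\subseteq V$ with $BW\subseteq W$ for all $B\in T$; it is irreducible if $W\ne 0$ and the only $T$-modules contained in $W$ are $0$ and $W$; an isomorphism of $T$-modules is a linear bijection commuting with all $B\in T$. The endpoint of an irreducible $T$-module $W$ is $\min\{i: 0\le i\le D,\ E_i^*W\ne 0\}$. An irreducible $T$-module $W$ with endpoint $1$ has local eigenvalue $\eta$ if $E_1^*W$ is one-dimensional and $E_1^*AE_1^*$ acts on it as the scalar $\eta$. The multiplicity with which an irreducible $T$-module $W$ appears in $V$ is the number of summands isomorphic to $W$ in a decomposition of $V$ as an orthogonal direct sum of irreducible $T$-modules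 (such a decomposition exists and the number does not depend on it). Then, up to isomorphism, there exist exactly two irreducible $T$-modules with endpoint $1$. The first has local eigenvalue $-1$ and appears in $V$ with multiplicity $\dfrac{k a_1}{a_1+1}$. The second has local eigenvalue $a_1$ and appears in $V$ with multiplicity $\dfrac{b_1}{a_1+1}$. -/

import Mathlib

open scoped Matrix

namespace SimpleGraph

variable {X : Type*}

/-- `Γ` is distance-regular with diameter `D` and intersection numbers `p h i j`
(written `p^h_{ij}` on paper): for vertices `y, z` at distance `h`, the number of vertices at
distance `i` from `y` and at distance `j` from `z` is `p h i j`. -/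
structure IsDistanceRegularWith (Γ : SimpleGraph X) (D : ℕ) (p : ℕ → ℕ → ℕ → ℕ) : Prop where
  connected : Γ.Connected
  diam_eq : Γ.diam = D
  ncard_eq : ∀ h i j, h ≤ D → i ≤ D → j ≤ D → ∀ y z : X, Γ.dist y z = h →
    {u : X | Γ.dist y u = i ∧ Γ.dist z u = j}.ncard = p h i j

/-- `c_i = p^i_{1,i-1}`, used for `1 ≤ i ≤ D`. -/
def cNum (p : ℕ → ℕ → ℕ → ℕ) (i : ℕ) : ℕ := p i 1 (i - 1)

/-- `a_i = p^i_{1,i}`, used for `0 ≤ i ≤ D`. -/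
def aNum (p : ℕ → ℕ → ℕ → ℕ) (i : ℕ) : ℕ := p i 1 i

/-- `b_i = p^i_{1,i+1}`, used for `0 ≤ i ≤ D - 1`. -/
def bNum (p : ℕ → ℕ → ℕ → ℕ) (i : ℕ) : ℕ := p i 1 (i + 1)

/-- The valency `k = p^0_{11}`. -/
def valency (p : ℕ → ℕ → ℕ → ℕ) : ℕ := p 0 1 1

/-- `1 + b + b^2 + ⋯ + b^(j-1)`. -/
def gaussBracket (b : ℝ) (j : ℕ) : ℝ := ∑ l ∈ Finset.range j, b ^ l

/-- The intersection numbers `p` are given by the classical parameters `(D, b, α, β)`. -/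
structure HasClassicalParameters (p : ℕ → ℕ → ℕ → ℕ) (D : ℕ) (b α β : ℝ) : Prop where
  c_eq : ∀ i, 1 ≤ i → i ≤ D →
    (cNum p i : ℝ) = gaussBracket b i * (1 + α * gaussBracket b (i - 1))
  b_eq : ∀ i, i < D →
    (bNum p i : ℝ) = (gaussBracket b D - gaussBracket b i) * (β - α * gaussBracket b i)

/-- The 4-tuple `u v w z` is a kite of length `i`, for `2 ≤ i`. -/
def IsKite (Γ : SimpleGraph X) (i : ℕ) (u v w z : X) : Prop :=
  Γ.Adj u v ∧ Γ.Adj u w ∧ Γ.Adj v w ∧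
    Γ.dist u z = i ∧ Γ.dist v z = i - 1 ∧ Γ.dist w z = i - 1

/-- A distance-regular graph with diameter `D` and intersection numbers `p` is a near polygon. -/
def IsNearPolygon (Γ : SimpleGraph X) (D : ℕ) (p : ℕ → ℕ → ℕ → ℕ) : Prop :=
  (∀ i, 1 ≤ i → i ≤ D - 1 → aNum p i = aNum p 1 * cNum p i) ∧
    ¬ ∃ u v w z : X, Γ.IsKite 2 u v w z

/-- The `i`-th distance matrix `A_i`. -/
noncomputable def distMatrix (Γ : SimpleGraph X) (i : ℕ) : Matrix X X ℂ :=
  Matrix.of fun y z => if Γ.dist y z = i then 1 else 0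

/-- The `i`-th dual idempotent `E*_i` with respect to the base vertex `x`. -/
noncomputable def dualIdempotent [DecidableEq X] (Γ : SimpleGraph X) (x : X) (i : ℕ) : Matrix X X ℂ :=
  Matrix.diagonal fun y => if Γ.dist x y = i then 1 else 0

/-- The Bose–Mesner algebra `M`, spanned by `A_0, …, A_D`. -/
def boseMesner (Γ : SimpleGraph X) : Submodule ℂ (Matrix X X ℂ) :=
  Submodule.span ℂ {B | ∃ i ≤ Γ.diam, B = Γ.distMatrix i}

/-- The dual Bose–Mesner algebra `M* = M*(x)`, spanned by `E*_0, …, E*_D`. -/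
def dualBoseMesner [DecidableEq X] (Γ : SimpleGraph X) (x : X) : Submodule ℂ (Matrix X X ℂ) :=
  Submodule.span ℂ {B | ∃ i ≤ Γ.diam, B = Γ.dualIdempotent x i}

variable [Fintype X] [DecidableEq X]

/-- The Terwilliger algebra `T = T(x)`, generated by `M` and `M*(x)`. -/
def terwilligerAlgebra (Γ : SimpleGraph X) (x : X) : Subalgebra ℂ (Matrix X X ℂ) :=
  Algebra.adjoin ℂ ((Γ.boseMesner : Set (Matrix X X ℂ)) ∪ (Γ.dualBoseMesner x : Set _))

/-- The subspace `W` of the standard module `V = ℂ^X` is a `T(x)`-module. -/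
def IsTModule (Γ : SimpleGraph X) (x : X) (W : Submodule ℂ (X → ℂ)) : Prop :=
  ∀ B ∈ Γ.terwilligerAlgebra x, ∀ w ∈ W, B *ᵥ w ∈ W

/-- `W` is an irreducible `T(x)`-module. -/
def IsIrreducibleTModule (Γ : SimpleGraph X) (x : X) (W : Submodule ℂ (X → ℂ)) : Prop :=
  Γ.IsTModule x W ∧ W ≠ ⊥ ∧ ∀ U ≤ W, Γ.IsTModule x U → U = ⊥ ∨ U = W

/-- The `T(x)`-modules `W` and `W'` are isomorphic: there is a linear isomorphism `σ : W → W'`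
with `σ (B w) = B (σ w)` for all `B ∈ T(x)` and `w ∈ W`. (Here `u` names the vector `B w`,
which lies in `W` as `W` is a `T(x)`-module.) -/
def TModuleIso (Γ : SimpleGraph X) (x : X) (W W' : Submodule ℂ (X → ℂ)) : Prop :=
  ∃ σ : W ≃ₗ[ℂ] W', ∀ B ∈ Γ.terwilligerAlgebra x, ∀ w u : W,
    (u : X → ℂ) = B *ᵥ (w : X → ℂ) → (σ u : X → ℂ) = B *ᵥ (σ w : X → ℂ)

/-- The subspace `E*_i W`. -/
noncomputable def dualComponent (Γ : SimpleGraph X) (x : X) (i : ℕ) (W : Submodule ℂ (X → ℂ)) :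
    Submodule ℂ (X → ℂ) :=
  W.map (Γ.dualIdempotent x i).mulVecLin

/-- `W` has endpoint `r`, that is, `r = min {i | 0 ≤ i ≤ D, E*_i W ≠ 0}`. -/
def HasEndpoint (Γ : SimpleGraph X) (x : X) (W : Submodule ℂ (X → ℂ)) (r : ℕ) : Prop :=
  IsLeast {i | i ≤ Γ.diam ∧ Γ.dualComponent x i W ≠ ⊥} r

/-- `W` (an irreducible `T(x)`-module with endpoint `1`) has local eigenvalue `η`: `E*_1 W` is
one-dimensional and `E*_1 A E*_1` acts on it as `η`. -/
def HasLocalEigenvalue (Γ : SimpleGraph X) (x : X) (W : Submodule ℂ (X → ℂ)) (η : ℂ) : Prop :=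
  Module.finrank ℂ (Γ.dualComponent x 1 W) = 1 ∧
    ∀ w ∈ Γ.dualComponent x 1 W,
      (Γ.dualIdempotent x 1 * Γ.distMatrix 1 * Γ.dualIdempotent x 1) *ᵥ w = η • w

/-- The standard module `V` is the orthogonal direct sum of the irreducible `T(x)`-modules in the
finite set `S`, for the Hermitian form `⟨u, v⟩ = uᵗ v̄`. -/
structure IsOrthogonalDecomposition (Γ : SimpleGraph X) (x : X)
    (S : Finset (Submodule ℂ (X → ℂ))) : Prop where
  irreducible : ∀ U ∈ S, Γ.IsIrreducibleTModule x U
  orthogonal : ∀ U ∈ S, ∀ U' ∈ S, U ≠ U' → ∀ u ∈ U, ∀ v ∈ U', u ⬝ᵥ star v = 0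
  sSup_eq : sSup (S : Set (Submodule ℂ (X → ℂ))) = ⊤

/-- The irreducible `T(x)`-module `W` appears in `V` with multiplicity `m`: the module `V` is an
orthogonal direct sum of irreducible `T(x)`-modules, and in every such sum the number of summands
isomorphic to `W` is `m`. -/
def AppearsWithMultiplicity (Γ : SimpleGraph X) (x : X) (W : Submodule ℂ (X → ℂ)) (m : ℕ) :
    Prop :=
  (∃ S, Γ.IsOrthogonalDecomposition x S) ∧
    ∀ S, Γ.IsOrthogonalDecomposition x S → {U | U ∈ S ∧ Γ.TModuleIso x U W}.ncard = m

end SimpleGraph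

/-! Classical parameters with `|b| ≠ 1` make `Γ` `Q`-polynomial. The matrices whose `(y, z)` entry
is a polynomial of degree less than `n` in `b^{-∂(y,z)}` form a flag on which multiplication by `A`
is triangular, so they are spanned by primitive idempotents `E_0, …, E_{n-1}` of `A`. The triple
products `E_i A*_1 E_j` with `|i - j| > 1` then vanish, and Terwilliger's balanced set condition
follows: over the `v` with `∂(y,v) = i` and `∂(z,v) = j`, minus those with `i` and `j` exchanged,
the column sums of `E_1` are multiples of the difference of the columns at `y` and `z`.

Evaluated on a kite of length 3, the balanced set condition equates a cardinality with `b` times a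
positive one, so `b < -1` excludes these kites, hence also those of length 2. Therefore adjacency is
transitive among the neighbours of `x`: the local graph is a disjoint union of cliques of size
`a_1 + 1`, and on the vectors orthogonal to the all-ones vector its eigenvalues are `-1` and `a_1`.

Finally, the vanishing triple products give, for a local eigenvector `v`, enough linear relations to
make the span of the vectors `E*_i A_j v` stable under `T`. Hence `E*_1 T E*_1` acts on each local
eigenspace by scalars, every nonzero vector of one eigenspace generates the same irreducible module
up to isomorphism, and its multiplicity is the dimension of the eigenspace, a trace.
-/

open SimpleGraph

namespace DistanceRegular

section Distances

variable {X : Type*} {Γ : SimpleGraph X} {D : ℕ} {p : ℕ → ℕ → ℕ → ℕ}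

theorem exists_adj_dist_eq (h : Γ.Connected) {y z : X} {n : ℕ} (hd : Γ.dist y z = n + 1) :
    ∃ u, Γ.Adj u z ∧ Γ.dist y u = n := by
  obtain ⟨q, hq⟩ := h.exists_walk_length_eq_dist y z
  have hnil : ¬ q.Nil := fun hn => by
    have := Walk.length_eq_zero_iff.mpr hn
    omega
  have hadj := q.adj_penultimate hnil
  refine ⟨q.penultimate, hadj, ?_⟩
  have hle : Γ.dist y q.penultimate ≤ q.length - 1 := by
    simpa only [Walk.length_dropLast] using Γ.dist_le q.dropLast
  have htri := h.dist_triangle (u := y) (v := q.penultimate) (w := z)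
  rw [dist_eq_one_iff_adj.mpr hadj] at htri
  omega

theorem dist_cases_of_dist_eq_one (h : Γ.Connected) {y u : X} (z : X) (hu : Γ.dist y u = 1) :
    Γ.dist z u = Γ.dist z y ∨ Γ.dist z u = Γ.dist z y + 1 ∨ Γ.dist z u + 1 = Γ.dist z y := by
  have h1 := h.dist_triangle (u := z) (v := y) (w := u)
  have h2 := h.dist_triangle (u := z) (v := u) (w := y)
  rw [Γ.dist_comm (u := u)] at h2
  omega

theorem dist_le_diameter [Finite X] (hΓ : Γ.IsDistanceRegularWith D p) (y z : X) :
    Γ.dist y z ≤ D := by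
  have : Nonempty X := ⟨y⟩
  rw [← hΓ.diam_eq]
  exact dist_le_diam (connected_iff_ediam_ne_top.mp hΓ.connected)

theorem exists_dist_eq (hΓ : Γ.IsDistanceRegularWith D p) {h : ℕ} (hh : h ≤ D) :
    ∃ y z, Γ.dist y z = h := by
  have := hΓ.connected.nonempty
  induction hh using Nat.decreasingInduction with
  | self => rw [← hΓ.diam_eq]; exact exists_dist_eq_diam
  | of_succ n _ ih =>
    obtain ⟨y, z, hyz⟩ := ih
    obtain ⟨u, -, hu⟩ := exists_adj_dist_eq hΓ.connected hyz
    exact ⟨y, u, hu⟩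

theorem card_dist_eq_dist_eq [Fintype X] (hΓ : Γ.IsDistanceRegularWith D p) {h i j : ℕ}
    (hi : i ≤ D) (hj : j ≤ D) {y z : X} (hd : Γ.dist y z = h) :
    (Finset.univ.filter fun u => Γ.dist y u = i ∧ Γ.dist z u = j).card = p h i j := by
  rw [← hΓ.ncard_eq h i j (hd ▸ dist_le_diameter hΓ y z) hi hj y z hd, ← Set.ncard_coe_finset]
  simp only [Finset.coe_filter, Finset.mem_univ, true_and]

theorem card_dist_eq_one [Fintype X] (hΓ : Γ.IsDistanceRegularWith D p) (hD : 1 ≤ D) (y : X) :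
    (Finset.univ.filter fun u => Γ.dist y u = 1).card = valency p := by
  rw [valency, ← card_dist_eq_dist_eq hΓ hD hD (Γ.dist_self (v := y))]
  simp only [and_self]

theorem cNum_zero [Finite X] (hΓ : Γ.IsDistanceRegularWith D p) (hD : 1 ≤ D) : cNum p 0 = 0 := by
  have := Fintype.ofFinite X
  obtain ⟨y⟩ := hΓ.connected.nonempty
  rw [cNum, ← card_dist_eq_dist_eq hΓ hD (Nat.zero_le D) (Γ.dist_self (v := y)),
    Finset.card_eq_zero, Finset.filter_eq_empty_iff]
  omega

theorem bNum_pos [Finite X] (hΓ : Γ.IsDistanceRegularWith D p) {i : ℕ} (hi : i < D) :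
    0 < bNum p i := by
  have := Fintype.ofFinite X
  obtain ⟨z, u, hzu⟩ := exists_dist_eq hΓ (Nat.succ_le_of_lt hi)
  obtain ⟨y, hyu, hzy⟩ := exists_adj_dist_eq hΓ.connected hzu
  rw [bNum, ← card_dist_eq_dist_eq hΓ (by omega) hi ((Γ.dist_comm (u := y)).trans hzy),
    Finset.card_pos]
  exact ⟨u, Finset.mem_filter.mpr ⟨Finset.mem_univ u, dist_eq_one_iff_adj.mpr hyu, hzu⟩⟩

theorem valency_eq [Finite X] (hΓ : Γ.IsDistanceRegularWith D p) (hD : 2 ≤ D) :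
    valency p = 1 + aNum p 1 + bNum p 1 := by
  classical
  have := Fintype.ofFinite X
  obtain ⟨y, z, hyz⟩ := exists_dist_eq hΓ (h := 1) (by omega)
  have hz : z ∈ Finset.univ.filter fun u => Γ.dist y u = 1 := by simpa using hyz
  have hself : ∀ u, Γ.dist z u = 0 ↔ u = z := fun u => by
    rw [hΓ.connected.dist_eq_zero_iff, eq_comm]
  rw [← card_dist_eq_one hΓ (by omega) y, aNum, bNum,
    ← card_dist_eq_dist_eq hΓ (by omega) (by omega) hyz,
    ← card_dist_eq_dist_eq hΓ (by omega) hD hyz, ← Finset.card_erase_add_one hz, add_comm 1,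
    add_right_comm, add_left_inj, ← Finset.card_union_of_disjoint]
  · congr 1
    ext u
    simp only [Finset.mem_erase, Finset.mem_filter, Finset.mem_univ, true_and,
      Finset.mem_union, ne_eq, ← hself]
    constructor
    · rintro ⟨hne, hu⟩
      have := dist_cases_of_dist_eq_one hΓ.connected z hu
      rw [Γ.dist_comm.trans hyz] at this
      omega
    · omega
  · exact Finset.disjoint_filter.mpr fun u _ h1 h2 => by omega

theorem sum_dist_eq_one [Fintype X] (hΓ : Γ.IsDistanceRegularWith D p) (hD : 1 ≤ D)
    {R : Type*} [Ring R] (f : ℕ → R) {y z : X} {i : ℕ} (hi : Γ.dist z y = i) :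
    ∑ u, (if Γ.dist y u = 1 then f (Γ.dist z u) else 0) =
      valency p * f i + cNum p i * (f (i - 1) - f i) +
        (if i < D then (bNum p i : R) else 0) * (f (i + 1) - f i) := by
  have hiD : i ≤ D := hi ▸ dist_le_diameter hΓ z y
  have hyz : Γ.dist y z = i := Γ.dist_comm.trans hi
  have split : ∀ u, (if Γ.dist y u = 1 then f (Γ.dist z u) else 0) =
      (if Γ.dist y u = 1 then f i else 0) +
      (if Γ.dist y u = 1 ∧ Γ.dist z u = i - 1 then f (i - 1) - f i else 0) +
      (if Γ.dist y u = 1 ∧ Γ.dist z u = i + 1 then f (i + 1) - f i else 0) := by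
    intro u
    by_cases hu : Γ.dist y u = 1
    · rcases dist_cases_of_dist_eq_one hΓ.connected z hu with h | h | h <;> rw [hi] at h
      · rcases Nat.eq_zero_or_pos i with h0 | h0
        · simp [hu, h, h0]
        · simp [hu, h, show i ≠ i - 1 by omega]
      · simp [hu, h, show i + 1 ≠ i - 1 by omega]
      · simp [hu, show Γ.dist z u = i - 1 by omega, show i - 1 ≠ i + 1 by omega]
    · simp [hu]
  rw [Finset.sum_congr rfl fun u _ => split u, Finset.sum_add_distrib, Finset.sum_add_distrib,
    ← Finset.sum_filter, ← Finset.sum_filter, ← Finset.sum_filter, Finset.sum_const,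
    Finset.sum_const, Finset.sum_const, card_dist_eq_one hΓ hD, nsmul_eq_mul, nsmul_eq_mul,
    nsmul_eq_mul, card_dist_eq_dist_eq hΓ hD (by omega) hyz]
  congr 2
  split_ifs with h
  · rw [card_dist_eq_dist_eq hΓ hD h hyz, bNum]
  · rw [Finset.filter_false_of_mem, Finset.card_empty, Nat.cast_zero]
    rintro u - ⟨-, hu⟩
    have := dist_le_diameter hΓ z u
    omega

end Distances

section DualFlag

open Polynomial

variable {X : Type*} {Γ : SimpleGraph X} {D : ℕ} {p : ℕ → ℕ → ℕ → ℕ} {φ θ : ℕ → ℝ} {n : ℕ}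

/-- The `i`-th distance matrix with real entries. -/
noncomputable def realDistMatrix (Γ : SimpleGraph X) (i : ℕ) : Matrix X X ℝ :=
  Matrix.of fun y z => if Γ.dist y z = i then 1 else 0

/-- The matrix with `(y, z)` entry `P (φ (∂(y, z)))`, for a polynomial `P`. -/
noncomputable def distPoly (Γ : SimpleGraph X) (φ : ℕ → ℝ) : ℝ[X] →ₗ[ℝ] Matrix X X ℝ where
  toFun P := Matrix.of fun y z => P.eval (φ (Γ.dist y z))
  map_add' P Q := by ext; simp
  map_smul' r P := by ext; simp

/-- The space of the matrices with entries `P (φ (∂(y, z)))`, where `P` has degree less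
than `n`. -/
noncomputable def polySpace (Γ : SimpleGraph X) (φ : ℕ → ℝ) (n : ℕ) :
    Submodule ℝ (Matrix X X ℝ) :=
  (degreeLT ℝ n).map (distPoly Γ φ)

theorem realDistMatrix_apply (i : ℕ) (y z : X) :
    realDistMatrix Γ i y z = if Γ.dist y z = i then 1 else 0 := rfl

theorem distPoly_apply (P : ℝ[X]) (y z : X) :
    distPoly Γ φ P y z = P.eval (φ (Γ.dist y z)) := rfl

theorem realDistMatrix_transpose (i : ℕ) : (realDistMatrix Γ i)ᵀ = realDistMatrix Γ i := by
  ext y z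
  rw [Matrix.transpose_apply, realDistMatrix_apply, realDistMatrix_apply, Γ.dist_comm]

theorem realDistMatrix_one_eq_adjMatrix [DecidableRel Γ.Adj] :
    realDistMatrix Γ 1 = Γ.adjMatrix ℝ := by
  ext y z
  simp only [realDistMatrix_apply, adjMatrix_apply, dist_eq_one_iff_adj]

theorem polySpace_mono {m n : ℕ} (h : m ≤ n) : polySpace Γ φ m ≤ polySpace Γ φ n :=
  Submodule.map_mono (degreeLT_mono h)

theorem polySpace_zero : polySpace Γ φ 0 = ⊥ := by
  rw [polySpace, eq_bot_iff]
  rintro _ ⟨P, hP, rfl⟩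
  rw [SetLike.mem_coe, mem_degreeLT, Nat.cast_zero, Nat.WithBot.lt_zero_iff, degree_eq_bot] at hP
  rw [hP, map_zero, Submodule.mem_bot]

theorem hadamard_mem_polySpace {m : ℕ} {B C : Matrix X X ℝ} (hB : B ∈ polySpace Γ φ (m + 1))
    (hC : C ∈ polySpace Γ φ (n + 1)) : B ⊙ C ∈ polySpace Γ φ (m + n + 1) := by
  obtain ⟨P, hP, rfl⟩ := hB
  obtain ⟨Q, hQ, rfl⟩ := hC
  refine ⟨P * Q, ?_, ?_⟩
  · rw [degreeLT_succ_eq_degreeLE, SetLike.mem_coe, mem_degreeLE] at hP hQ ⊢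
    exact degree_mul_le_of_le hP hQ
  · ext y z
    simp only [distPoly_apply, eval_mul, Matrix.hadamard_apply]

theorem of_dist_mem_polySpace [Finite X] (hΓ : Γ.IsDistanceRegularWith D p)
    (hφ : Set.InjOn φ (Set.Iic D)) (f : ℕ → ℝ) :
    (Matrix.of fun y z => f (Γ.dist y z)) ∈ polySpace Γ φ (D + 1) := by
  have hinj : Set.InjOn φ (Finset.range (D + 1)) :=
    hφ.mono fun i hi => Nat.lt_succ_iff.mp (Finset.mem_range.mp hi)
  refine ⟨Lagrange.interpolate (Finset.range (D + 1)) φ f, ?_, ?_⟩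
  · rw [SetLike.mem_coe, mem_degreeLT]
    simpa only [Finset.card_range] using Lagrange.degree_interpolate_lt f hinj
  · ext y z
    have hyz := dist_le_diameter hΓ y z
    exact Lagrange.eval_interpolate_at_node f hinj (Finset.mem_range.mpr (by omega))

theorem one_mem_polySpace [Finite X] [DecidableEq X] (hΓ : Γ.IsDistanceRegularWith D p)
    (hφ : Set.InjOn φ (Set.Iic D)) : (1 : Matrix X X ℝ) ∈ polySpace Γ φ (D + 1) := by
  convert of_dist_mem_polySpace hΓ hφ (fun i => if i = 0 then 1 else 0) using 1
  ext y z
  simp only [Matrix.one_apply, Matrix.of_apply, hΓ.connected.dist_eq_zero_iff]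

variable [Fintype X]

/-- `φ` is a dual eigenvalue sequence of a `Q`-polynomial structure, with eigenvalues `θ`: the
first `D + 1` values of `φ` are distinct and multiplication by `A` is triangular on the flag of
the spaces `polySpace Γ φ n`, with the scalar `θ n` on the `n`-th quotient. -/
structure HasDualFlag (Γ : SimpleGraph X) (D : ℕ) (φ θ : ℕ → ℝ) : Prop where
  injOn : Set.InjOn φ (Set.Iic D)
  adj_mul_sub_mem : ∀ n, ∀ B ∈ polySpace Γ φ (n + 1),
    realDistMatrix Γ 1 * B - θ n • B ∈ polySpace Γ φ n

theorem HasDualFlag.adj_mul_mem (hφ : HasDualFlag Γ D φ θ) {B : Matrix X X ℝ}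
    (hB : B ∈ polySpace Γ φ n) : realDistMatrix Γ 1 * B ∈ polySpace Γ φ n := by
  rcases n with _ | n
  · rw [polySpace_zero, Submodule.mem_bot] at hB ⊢
    rw [hB, mul_zero]
  · have h := polySpace_mono (Nat.le_succ n) (hφ.adj_mul_sub_mem n B hB)
    simpa only [sub_add_cancel] using add_mem h (Submodule.smul_mem _ (θ n) hB)

variable [DecidableEq X]

theorem HasDualFlag.aeval_mul_mem (hφ : HasDualFlag Γ D φ θ) (q : ℝ[X]) {B : Matrix X X ℝ}
    (hB : B ∈ polySpace Γ φ n) : aeval (realDistMatrix Γ 1) q * B ∈ polySpace Γ φ n := by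
  have hpow : ∀ m : ℕ, realDistMatrix Γ 1 ^ m * B ∈ polySpace Γ φ n := by
    intro m
    induction m with
    | zero => rwa [pow_zero, one_mul]
    | succ m ih => rw [pow_succ', mul_assoc]; exact hφ.adj_mul_mem ih
  rw [aeval_eq_sum_range, Finset.sum_mul]
  refine Submodule.sum_mem _ fun m _ => ?_
  rw [smul_mul_assoc]
  exact Submodule.smul_mem _ _ (hpow m)

theorem HasDualFlag.aeval_nodal_mul_eq_zero (hφ : HasDualFlag Γ D φ θ) {B : Matrix X X ℝ}
    (hB : B ∈ polySpace Γ φ n) :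
    aeval (realDistMatrix Γ 1) (Lagrange.nodal (Finset.range n) θ) * B = 0 := by
  induction n generalizing B with
  | zero =>
    rw [polySpace_zero, Submodule.mem_bot] at hB
    rw [hB, mul_zero]
  | succ n ih =>
    have h := ih (hφ.adj_mul_sub_mem n B hB)
    rw [Lagrange.nodal_eq, Finset.prod_range_succ, ← Lagrange.nodal_eq, map_mul, mul_assoc]
    simpa only [map_sub, aeval_X, aeval_C, sub_mul, Algebra.algebraMap_eq_smul_one,
      smul_mul_assoc, one_mul] using h

theorem transpose_aeval (A : Matrix X X ℝ) (q : ℝ[X]) : (aeval A q)ᵀ = aeval Aᵀ q := by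
  rw [aeval_eq_sum_range, aeval_eq_sum_range, Matrix.transpose_sum]
  simp only [Matrix.transpose_smul, Matrix.transpose_pow]

theorem transpose_aeval_realDistMatrix (i : ℕ) (q : ℝ[X]) :
    (aeval (realDistMatrix Γ i) q)ᵀ = aeval (realDistMatrix Γ i) q := by
  rw [transpose_aeval, realDistMatrix_transpose]

theorem aeval_ne_zero (hΓ : Γ.IsDistanceRegularWith D p) {P : ℝ[X]} (hP : P ≠ 0)
    (hdeg : P.natDegree ≤ D) : aeval (realDistMatrix Γ 1) P ≠ 0 := by
  classical
  intro h0
  obtain ⟨y, z, hyz⟩ := exists_dist_eq hΓ hdeg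
  have hshort : ∀ i < P.natDegree, (realDistMatrix Γ 1 ^ i) y z = 0 := by
    intro i hi
    rw [realDistMatrix_one_eq_adjMatrix, adjMatrix_pow_apply_eq_card_walk,
      Fintype.card_eq_zero_iff.mpr, Nat.cast_zero]
    exact ⟨fun q => by have h := Γ.dist_le q.1; rw [q.2.out] at h; omega⟩
  have hgeodesic : (realDistMatrix Γ 1 ^ P.natDegree) y z ≠ 0 := by
    obtain ⟨q, hq⟩ := hΓ.connected.exists_walk_length_eq_dist y z
    rw [realDistMatrix_one_eq_adjMatrix, adjMatrix_pow_apply_eq_card_walk, Nat.cast_ne_zero]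
    exact (Fintype.card_pos_iff.mpr ⟨q, hq.trans hyz⟩).ne'
  have h := congrFun (congrFun h0 y) z
  rw [aeval_eq_sum_range, Matrix.sum_apply, Finset.sum_range_succ, Finset.sum_eq_zero, zero_add,
    Matrix.smul_apply, Matrix.zero_apply, smul_eq_mul, mul_eq_zero] at h
  · exact h.elim (fun h => hP (leadingCoeff_eq_zero.mp h)) hgeodesic
  · intro i hi
    rw [Matrix.smul_apply, hshort i (Finset.mem_range.mp hi), smul_zero]

omit [DecidableEq X] in
theorem HasDualFlag.injOn_eigenvalue (hφ : HasDualFlag Γ D φ θ)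
    (hΓ : Γ.IsDistanceRegularWith D p) : Set.InjOn θ (Finset.range (D + 1)) := by
  classical
  intro m hm n hn hmn
  by_contra hne
  have hm' : m ∈ Finset.range (D + 1) := hm
  have hn' : n ∈ (Finset.range (D + 1)).erase m := Finset.mem_erase.mpr ⟨Ne.symm hne, hn⟩
  -- A repeated root of the annihilating polynomial of the symmetric matrix `A` can be dropped,
  -- which leaves an annihilating polynomial of degree `D`.
  have hX : aeval (realDistMatrix Γ 1) (Polynomial.X - C (θ m)) =
      (aeval (realDistMatrix Γ 1) (Polynomial.X - C (θ m)))ᴴ := by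
    rw [Matrix.conjTranspose_eq_transpose_of_trivial, transpose_aeval_realDistMatrix]
  have h := hφ.aeval_nodal_mul_eq_zero (one_mem_polySpace hΓ hφ.injOn)
  rw [mul_one, Lagrange.nodal_eq_mul_nodal_erase hm', Lagrange.nodal_eq_mul_nodal_erase hn',
    ← hmn, map_mul, map_mul, ← mul_assoc] at h
  nth_rewrite 1 [hX] at h
  rw [Matrix.conjTranspose_mul_self_mul_eq_zero, ← map_mul, hmn,
    ← Lagrange.nodal_eq_mul_nodal_erase hn'] at h
  refine aeval_ne_zero hΓ Lagrange.nodal_ne_zero ?_ h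
  rw [Lagrange.natDegree_nodal, Finset.card_erase_of_mem hm', Finset.card_range,
    Nat.add_sub_cancel]

theorem HasDualFlag.exists_aeval_eq (hφ : HasDualFlag Γ D φ θ)
    (hΓ : Γ.IsDistanceRegularWith D p) {B : Matrix X X ℝ} (hB : B ∈ polySpace Γ φ (D + 1)) :
    ∃ q : ℝ[X], aeval (realDistMatrix Γ 1) q = B := by
  let F : ℝ[X] →ₗ[ℝ] Matrix X X ℝ := (aeval (realDistMatrix Γ 1)).toLinearMap
  have hle : (degreeLT ℝ (D + 1)).map F ≤ polySpace Γ φ (D + 1) := by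
    rintro _ ⟨q, -, rfl⟩
    have h := hφ.aeval_mul_mem q (one_mem_polySpace hΓ hφ.injOn)
    rwa [mul_one] at h
  have hker : LinearMap.ker (F.domRestrict (degreeLT ℝ (D + 1))) = ⊥ := by
    refine LinearMap.ker_eq_bot'.mpr fun q hq => Subtype.ext ?_
    by_contra hq0
    refine aeval_ne_zero hΓ hq0 (Nat.lt_succ_iff.mp ?_) hq
    exact (natDegree_lt_iff_degree_lt hq0).mpr (mem_degreeLT.mp q.2)
  have hfin : FiniteDimensional ℝ (degreeLT ℝ (D + 1)) :=
    Module.Finite.equiv (degreeLTEquiv ℝ (D + 1)).symm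
  have hdim : Module.finrank ℝ (polySpace Γ φ (D + 1)) ≤
      Module.finrank ℝ ((degreeLT ℝ (D + 1)).map F) := by
    refine (Submodule.finrank_map_le _ _).trans (le_of_eq ?_)
    rw [← LinearMap.range_domRestrict,
      LinearMap.finrank_range_of_inj (LinearMap.ker_eq_bot.mp hker)]
  obtain ⟨q, -, hq⟩ := (Submodule.eq_of_le_of_finrank_le hle hdim).symm ▸ hB
  exact ⟨q, hq⟩

end DualFlag

section ClassicalParameters

open Polynomial

variable {X : Type*} {Γ : SimpleGraph X} {D : ℕ} {p : ℕ → ℕ → ℕ → ℕ} {b α β : ℝ}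

theorem gaussBracket_eq (hb : b ≠ 1) (j : ℕ) : gaussBracket b j = (b ^ j - 1) * (b - 1)⁻¹ := by
  rw [gaussBracket, geom_sum_eq hb, div_eq_mul_inv]

theorem inv_pow_injective (hb0 : b ≠ 0) (hb1 : |b| ≠ 1) :
    Function.Injective fun i : ℕ => b⁻¹ ^ i := by
  intro i j h
  refine pow_right_injective₀ (abs_pos.mpr (inv_ne_zero hb0)) ?_
    ((abs_pow _ _).symm.trans ((congrArg abs h).trans (abs_pow _ _)))
  rwa [abs_inv, ne_eq, inv_eq_one]

-- The relation between `c₂` and `d₂` removes the term of degree `-1` from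
-- `exists_eval_eq_laurent` below, which would otherwise spoil the triangularity of `A` at `n = 1`.
theorem exists_quadratic_cNum_bNum [Finite X] (hΓ : Γ.IsDistanceRegularWith D p)
    (hcl : HasClassicalParameters p D b α β) (hD : 1 ≤ D) (hb0 : b ≠ 0) (hb1 : b ≠ 1) :
    ∃ c₀ c₁ c₂ d₀ d₁ d₂ : ℝ, c₂ * (b - 1) + d₂ * (b⁻¹ - 1) = 0 ∧
      ∀ i ≤ D, (cNum p i : ℝ) = c₀ + c₁ * b ^ i + c₂ * (b ^ i) ^ 2 ∧
        (if i < D then (bNum p i : ℝ) else 0) = d₀ + d₁ * b ^ i + d₂ * (b ^ i) ^ 2 := by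
  have hb1' : b - 1 ≠ 0 := sub_ne_zero.mpr hb1
  obtain ⟨e, he⟩ : ∃ e, e = (b - 1)⁻¹ := ⟨_, rfl⟩
  refine ⟨-e * (1 - α * e), e * (1 - α * e) - e ^ 2 * α * b⁻¹, e ^ 2 * α * b⁻¹,
    b ^ D * e * (β + α * e), -e * (β + α * e) - b ^ D * e * α * e, e ^ 2 * α, ?_,
    fun i hi => ⟨?_, ?_⟩⟩
  · field_simp
    ring
  · rcases i with _ | i
    · rw [cNum_zero hΓ hD, Nat.cast_zero]
      ring
    · rw [hcl.c_eq _ (Nat.succ_pos i) hi, Nat.succ_eq_add_one, Nat.add_sub_cancel,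
        gaussBracket_eq hb1, gaussBracket_eq hb1, he]
      simp only [pow_succ]
      field_simp
      ring
  · have hbi : (if i < D then (bNum p i : ℝ) else 0) =
        (gaussBracket b D - gaussBracket b i) * (β - α * gaussBracket b i) := by
      split_ifs with h
      · exact hcl.b_eq i h
      · rw [show i = D by omega, sub_self, zero_mul]
    rw [hbi, gaussBracket_eq hb1, gaussBracket_eq hb1, he]
    field_simp
    ring

theorem exists_eval_eq_laurent {c₂ d₂ : ℝ} (h : c₂ * (b - 1) + d₂ * (b⁻¹ - 1) = 0)
    (c₁ d₁ : ℝ) (n : ℕ) :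
    ∃ Q ∈ degreeLT ℝ n, ∀ u w : ℝ, u * w = 1 →
      ((c₁ * u + c₂ * u ^ 2) * (b ^ n - 1) + (d₁ * u + d₂ * u ^ 2) * (b⁻¹ ^ n - 1)) * w ^ n =
        Q.eval w := by
  rcases n with _ | _ | n
  · refine ⟨0, zero_mem _, fun u w _ => ?_⟩
    rw [eval_zero]
    ring
  · refine ⟨C (c₁ * (b - 1) + d₁ * (b⁻¹ - 1)),
      mem_degreeLT.mpr (degree_C_le.trans_lt (by norm_num)), fun u w huw => ?_⟩
    rw [eval_C]
    linear_combination (c₁ * (b - 1) + d₁ * (b⁻¹ - 1)) * huw + u ^ 2 * w * h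
  · rw [show n + 1 + 1 = n + 2 from rfl]
    generalize b ^ (n + 2) = r
    generalize b⁻¹ ^ (n + 2) = s
    refine ⟨C (c₁ * (r - 1) + d₁ * (s - 1)) * Polynomial.X ^ (n + 1) +
      C (c₂ * (r - 1) + d₂ * (s - 1)) * Polynomial.X ^ n, add_mem ?_ ?_, fun u w huw => ?_⟩
    · exact mem_degreeLT.mpr ((degree_C_mul_X_pow_le _ _).trans_lt (by exact_mod_cast (by omega)))
    · exact mem_degreeLT.mpr ((degree_C_mul_X_pow_le _ _).trans_lt (by exact_mod_cast (by omega)))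
    · simp only [eval_add, eval_mul, eval_C, eval_pow, eval_X]
      linear_combination (c₁ * (r - 1) + d₁ * (s - 1)) * w ^ (n + 1) * huw +
        (c₂ * (r - 1) + d₂ * (s - 1)) * w ^ n * (u * w + 1) * huw

variable [Fintype X]

theorem adj_mul_distPoly_X_pow_apply (hΓ : Γ.IsDistanceRegularWith D p) (hD : 1 ≤ D)
    (hb0 : b ≠ 0) (n : ℕ) {i : ℕ} {y z : X} (hi : Γ.dist y z = i) :
    (realDistMatrix Γ 1 * distPoly Γ (fun i => b⁻¹ ^ i) (Polynomial.X ^ n)) y z =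
      (valency p + cNum p i * (b ^ n - 1) +
        (if i < D then (bNum p i : ℝ) else 0) * (b⁻¹ ^ n - 1)) * (b⁻¹ ^ i) ^ n := by
  have hsum := sum_dist_eq_one hΓ hD (fun i => (b⁻¹ ^ i) ^ n) (Γ.dist_comm.trans hi)
  have hprev : (cNum p i : ℝ) * ((b⁻¹ ^ (i - 1)) ^ n - (b⁻¹ ^ i) ^ n) =
      cNum p i * ((b ^ n - 1) * (b⁻¹ ^ i) ^ n) := by
    rcases i with _ | i
    · rw [cNum_zero hΓ hD, Nat.cast_zero, zero_mul, zero_mul]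
    · simp only [Nat.add_sub_cancel, pow_succ, mul_pow, inv_pow]
      field_simp
  rw [Matrix.mul_apply]
  simp only [realDistMatrix_apply, distPoly_apply, eval_pow, eval_X, ite_mul, one_mul, zero_mul]
  rw [Finset.sum_congr rfl fun u _ => by rw [Γ.dist_comm (u := u) (v := z)], hsum, hprev,
    pow_succ, mul_pow]
  split_ifs <;> ring

theorem hasDualFlag_of_X_pow {φ θ : ℕ → ℝ} (hφ : Set.InjOn φ (Set.Iic D))
    (h : ∀ n, realDistMatrix Γ 1 * distPoly Γ φ (Polynomial.X ^ n) -
      θ n • distPoly Γ φ (Polynomial.X ^ n) ∈ polySpace Γ φ n) : HasDualFlag Γ D φ θ := by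
  classical
  refine ⟨hφ, fun n B hB => ?_⟩
  obtain ⟨P, hP, rfl⟩ := hB
  let G : ℝ[X] →ₗ[ℝ] Matrix X X ℝ :=
    (LinearMap.mulLeft ℝ (realDistMatrix Γ 1) - θ n • LinearMap.id) ∘ₗ distPoly Γ φ
  suffices hG : degreeLT ℝ (n + 1) ≤ (polySpace Γ φ n).comap G from hG hP
  rw [degreeLT_eq_span_X_pow, Submodule.span_le]
  intro Q hQ
  obtain ⟨m, hm, rfl⟩ := Finset.mem_image.mp hQ
  change realDistMatrix Γ 1 * distPoly Γ φ (Polynomial.X ^ m) -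
    θ n • distPoly Γ φ (Polynomial.X ^ m) ∈ polySpace Γ φ n
  rcases Nat.lt_succ_iff_lt_or_eq.mp (Finset.mem_range.mp hm) with hm | rfl
  · have hX : distPoly Γ φ (Polynomial.X ^ m) ∈ polySpace Γ φ n := by
      refine Submodule.mem_map_of_mem ?_
      rw [mem_degreeLT, degree_X_pow]
      exact_mod_cast hm
    rw [← sub_add_sub_cancel _ (θ m • distPoly Γ φ (Polynomial.X ^ m)), ← sub_smul]
    exact add_mem (polySpace_mono hm.le (h m)) (Submodule.smul_mem _ _ hX)
  · exact h m

theorem exists_hasDualFlag (hΓ : Γ.IsDistanceRegularWith D p)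
    (hcl : HasClassicalParameters p D b α β) (hD : 1 ≤ D) (hb0 : b ≠ 0) (hb1 : |b| ≠ 1) :
    ∃ θ, HasDualFlag Γ D (fun i => b⁻¹ ^ i) θ := by
  obtain ⟨c₀, c₁, c₂, d₀, d₁, d₂, hcd₂, hcd⟩ := exists_quadratic_cNum_bNum hΓ hcl hD hb0
    (fun h => hb1 (by rw [h, abs_one]))
  refine ⟨fun n => valency p + c₀ * (b ^ n - 1) + d₀ * (b⁻¹ ^ n - 1),
    hasDualFlag_of_X_pow (inv_pow_injective hb0 hb1).injOn fun n => ?_⟩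
  obtain ⟨Q, hQ, hQeval⟩ := exists_eval_eq_laurent hcd₂ c₁ d₁ n
  refine ⟨Q, hQ, ?_⟩
  ext y z
  obtain ⟨hc, hd⟩ := hcd _ (dist_le_diameter hΓ y z)
  rw [distPoly_apply, ← hQeval (b ^ Γ.dist y z) (b⁻¹ ^ Γ.dist y z) (by
    rw [← mul_pow, mul_inv_cancel₀ hb0, one_pow]), Matrix.sub_apply,
    adj_mul_distPoly_X_pow_apply hΓ hD hb0 n rfl, hc, hd, Matrix.smul_apply, distPoly_apply,
    eval_pow, eval_X, smul_eq_mul]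
  ring

end ClassicalParameters

section PrimitiveIdempotents

open Polynomial

variable {X : Type*} [Fintype X] [DecidableEq X] {Γ : SimpleGraph X} {D : ℕ}
  {p : ℕ → ℕ → ℕ → ℕ} {φ θ : ℕ → ℝ} {i j n : ℕ}

theorem HasDualFlag.aeval_congr (hφ : HasDualFlag Γ D φ θ) (hΓ : Γ.IsDistanceRegularWith D p)
    {q r : ℝ[X]} (h : ∀ i ∈ Finset.range (D + 1), q.eval (θ i) = r.eval (θ i)) :
    aeval (realDistMatrix Γ 1) q = aeval (realDistMatrix Γ 1) r := by
  have hdvd : Lagrange.nodal (Finset.range (D + 1)) θ ∣ q - r := by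
    rw [Lagrange.nodal_eq]
    refine Finset.prod_dvd_of_coprime (fun m hm n hn hmn => ?_) fun m hm => ?_
    · exact isCoprime_X_sub_C_of_isUnit_sub
        (IsUnit.mk0 _ (sub_ne_zero.mpr fun h => hmn (hφ.injOn_eigenvalue hΓ hm hn h)))
    · rw [dvd_iff_isRoot, IsRoot, eval_sub, h m hm, sub_self]
  obtain ⟨s, hs⟩ := hdvd
  have hnodal := hφ.aeval_nodal_mul_eq_zero (one_mem_polySpace hΓ hφ.injOn)
  rw [mul_one] at hnodal
  rw [← sub_eq_zero, ← map_sub, hs, map_mul, hnodal, zero_mul]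

/-- The primitive idempotent `E_i` of the adjacency matrix for the eigenvalue `θ i`, where
`θ 0, …, θ D` are the eigenvalues. -/
noncomputable def primitiveIdempotent (Γ : SimpleGraph X) (D : ℕ) (θ : ℕ → ℝ) (i : ℕ) :
    Matrix X X ℝ :=
  aeval (realDistMatrix Γ 1) (Lagrange.basis (Finset.range (D + 1)) θ i)

theorem HasDualFlag.aeval_mul_primitiveIdempotent (hφ : HasDualFlag Γ D φ θ)
    (hΓ : Γ.IsDistanceRegularWith D p) (i : ℕ) (q : ℝ[X]) :
    aeval (realDistMatrix Γ 1) q * primitiveIdempotent Γ D θ i =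
      q.eval (θ i) • primitiveIdempotent Γ D θ i := by
  rw [primitiveIdempotent, ← map_mul, ← map_smul]
  refine hφ.aeval_congr hΓ fun m hm => ?_
  rw [eval_mul, eval_smul, smul_eq_mul]
  by_cases hmi : i = m
  · rw [hmi]
  · rw [Lagrange.eval_basis_of_ne hmi hm, mul_zero, mul_zero]

theorem HasDualFlag.aeval_eq_sum_primitiveIdempotent (hφ : HasDualFlag Γ D φ θ)
    (hΓ : Γ.IsDistanceRegularWith D p) (q : ℝ[X]) :
    aeval (realDistMatrix Γ 1) q =
      ∑ i ∈ Finset.range (D + 1), q.eval (θ i) • primitiveIdempotent Γ D θ i := by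
  have hone : ∑ i ∈ Finset.range (D + 1), primitiveIdempotent Γ D θ i = 1 := by
    simp only [primitiveIdempotent]
    rw [← map_sum, Lagrange.sum_basis (hφ.injOn_eigenvalue hΓ) ⟨0, by simp⟩, map_one]
  rw [← mul_one (aeval _ q), ← hone, Finset.mul_sum]
  exact Finset.sum_congr rfl fun i _ => hφ.aeval_mul_primitiveIdempotent hΓ i q

theorem HasDualFlag.isStarProjection_primitiveIdempotent (hφ : HasDualFlag Γ D φ θ)
    (hΓ : Γ.IsDistanceRegularWith D p) (hi : i ∈ Finset.range (D + 1)) :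
    IsStarProjection (primitiveIdempotent Γ D θ i) where
  isIdempotentElem := by
    have h := hφ.aeval_mul_primitiveIdempotent hΓ i (Lagrange.basis (Finset.range (D + 1)) θ i)
    rwa [Lagrange.eval_basis_self (hφ.injOn_eigenvalue hΓ) hi, one_smul] at h
  isSelfAdjoint := by
    rw [IsSelfAdjoint, Matrix.star_eq_conjTranspose, Matrix.conjTranspose_eq_transpose_of_trivial]
    exact transpose_aeval_realDistMatrix 1 _

theorem HasDualFlag.primitiveIdempotent_mul_eq_zero (hφ : HasDualFlag Γ D φ θ)
    (hΓ : Γ.IsDistanceRegularWith D p) (hi : i ∈ Finset.range (D + 1)) {B : Matrix X X ℝ}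
    (hB : B ∈ polySpace Γ φ i) : primitiveIdempotent Γ D θ i * B = 0 := by
  have hcomm : primitiveIdempotent Γ D θ i *
      aeval (realDistMatrix Γ 1) (Lagrange.nodal (Finset.range i) θ) =
      (Lagrange.nodal (Finset.range i) θ).eval (θ i) • primitiveIdempotent Γ D θ i := by
    rw [← hφ.aeval_mul_primitiveIdempotent hΓ i, primitiveIdempotent, ← map_mul, ← map_mul,
      mul_comm]
  have h := congrArg (primitiveIdempotent Γ D θ i * ·) (hφ.aeval_nodal_mul_eq_zero hB)
  simp only [mul_zero] at h
  rw [← mul_assoc, hcomm, smul_mul_assoc] at h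
  refine (smul_eq_zero.mp h).resolve_left (Lagrange.eval_nodal_not_at_node fun j hj hij => ?_)
  have hj' := Finset.mem_range.mp hj
  have hi' := Finset.mem_range.mp hi
  have := hφ.injOn_eigenvalue hΓ hi (Finset.mem_range.mpr (hj'.trans hi')) hij
  omega

omit [DecidableEq X] in
theorem HasDualFlag.mem_polySpace_of_adj_mul_eq_smul (hφ : HasDualFlag Γ D φ θ)
    (hΓ : Γ.IsDistanceRegularWith D p) (hi : i ≤ D) {B : Matrix X X ℝ}
    (hA : realDistMatrix Γ 1 * B = θ i • B) (hn : n ≤ D + 1) (hB : B ∈ polySpace Γ φ n) :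
    B ∈ polySpace Γ φ (i + 1) := by
  classical
  induction n with
  | zero => exact polySpace_mono (Nat.zero_le _) hB
  | succ n ih =>
    rcases le_or_gt n i with hni | hni
    · exact polySpace_mono (Nat.succ_le_succ hni) hB
    · refine ih (by omega) ?_
      have h := hφ.adj_mul_sub_mem n B hB
      rw [hA, ← sub_smul] at h
      refine (Submodule.smul_mem_iff _ (sub_ne_zero.mpr fun hθ => hni.ne ?_)).mp h
      exact hφ.injOn_eigenvalue hΓ (Finset.mem_range.mpr (by omega))
        (Finset.mem_range.mpr (by omega)) hθ

theorem HasDualFlag.primitiveIdempotent_mem_polySpace (hφ : HasDualFlag Γ D φ θ)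
    (hΓ : Γ.IsDistanceRegularWith D p) (hi : i ∈ Finset.range (D + 1)) :
    primitiveIdempotent Γ D θ i ∈ polySpace Γ φ (i + 1) := by
  refine hφ.mem_polySpace_of_adj_mul_eq_smul hΓ (Nat.lt_succ_iff.mp (Finset.mem_range.mp hi)) ?_
    le_rfl ?_
  · have h := hφ.aeval_mul_primitiveIdempotent hΓ i Polynomial.X
    rwa [aeval_X, eval_X] at h
  · have h := hφ.aeval_mul_mem (Lagrange.basis (Finset.range (D + 1)) θ i)
      (one_mem_polySpace hΓ hφ.injOn)
    rwa [mul_one] at h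

theorem sum_trace_mul_diagonal_mul {E F Φ : Matrix X X ℝ} (hE : IsStarProjection E)
    (hF : IsStarProjection F) (hΦ : Φᵀ = Φ) :
    ∑ o, ((E * Matrix.diagonal (Φ o) * F) * (E * Matrix.diagonal (Φ o) * F)ᴴ).trace =
      (E * (F ⊙ (Φ * Φ))).trace := by
  have htrace : ∀ S : Matrix X X ℝ, Sᴴ = S →
      ((E * S * F) * (E * S * F)ᴴ).trace = (E * (S * F * S)).trace := by
    intro S hS
    rw [Matrix.conjTranspose_mul, Matrix.conjTranspose_mul, hS, ← Matrix.star_eq_conjTranspose,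
      ← Matrix.star_eq_conjTranspose, hE.isSelfAdjoint.star_eq, hF.isSelfAdjoint.star_eq,
      show E * S * F * (F * (S * E)) = (E * S * (F * F) * S) * E by noncomm_ring,
      Matrix.trace_mul_comm, hF.isIdempotentElem.eq,
      show E * (E * S * F * S) = (E * E) * (S * F * S) by noncomm_ring, hE.isIdempotentElem.eq]
  rw [Finset.sum_congr rfl fun o _ => htrace (Matrix.diagonal (Φ o))
    (by rw [Matrix.diagonal_conjTranspose, star_trivial]), ← Matrix.trace_sum, ← Matrix.mul_sum]
  congr 2
  ext y z
  rw [Matrix.sum_apply, Matrix.hadamard_apply, Matrix.mul_apply, Finset.mul_sum]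
  refine Finset.sum_congr rfl fun o _ => ?_
  rw [Matrix.mul_diagonal, Matrix.diagonal_mul, ← Matrix.transpose_apply Φ y o, hΦ]
  ring

/-- The diagonal matrix with `(y, y)` entry `φ (∂(o, y))`. -/
noncomputable def dualAdjMatrix (Γ : SimpleGraph X) (φ : ℕ → ℝ) (o : X) : Matrix X X ℝ :=
  Matrix.diagonal fun y => φ (Γ.dist o y)

-- This is the vanishing of the Krein parameter `q^i_{1j}`.
theorem HasDualFlag.primitiveIdempotent_mul_dualAdjMatrix_mul (hφ : HasDualFlag Γ D φ θ)
    (hΓ : Γ.IsDistanceRegularWith D p) (hi : i ∈ Finset.range (D + 1)) (hij : j + 1 < i) (o : X) :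
    primitiveIdempotent Γ D θ i * dualAdjMatrix Γ φ o * primitiveIdempotent Γ D θ j = 0 := by
  have hj : j ∈ Finset.range (D + 1) := Finset.mem_range.mpr
    ((Nat.lt_of_succ_lt hij).trans (Finset.mem_range.mp hi))
  obtain ⟨Φ, hΦ⟩ : ∃ Φ, Φ = distPoly Γ φ Polynomial.X := ⟨_, rfl⟩
  have hΦ_apply : ∀ y z, Φ y z = φ (Γ.dist y z) := fun y z => by
    rw [hΦ, distPoly_apply, eval_X]
  have hΦt : Φᵀ = Φ := by
    ext y z
    rw [Matrix.transpose_apply, hΦ_apply, hΦ_apply, Γ.dist_comm]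
  have hdual : ∀ o, dualAdjMatrix Γ φ o = Matrix.diagonal (Φ o) := fun o =>
    congrArg Matrix.diagonal (funext fun y => (hΦ_apply o y).symm)
  have hmem : Φ ∈ polySpace Γ φ 2 :=
    hΦ ▸ Submodule.mem_map_of_mem (mem_degreeLT.mpr (degree_X_le.trans_lt (by norm_num)))
  have hsq : Φ * Φ ∈ polySpace Γ φ 2 := by
    obtain ⟨q, hq⟩ := hφ.exists_aeval_eq hΓ (of_dist_mem_polySpace hΓ hφ.injOn φ)
    rw [show Matrix.of (fun y z => φ (Γ.dist y z)) = Φ from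
      Matrix.ext fun y z => (hΦ_apply y z).symm] at hq
    exact hq ▸ hφ.aeval_mul_mem q (hq.symm ▸ hmem)
  have hsum := sum_trace_mul_diagonal_mul (hφ.isStarProjection_primitiveIdempotent hΓ hi)
    (hφ.isStarProjection_primitiveIdempotent hΓ hj) hΦt
  rw [hφ.primitiveIdempotent_mul_eq_zero hΓ hi (polySpace_mono (by omega)
    (hadamard_mem_polySpace (hφ.primitiveIdempotent_mem_polySpace hΓ hj) hsq)), Matrix.trace_zero,
    Finset.sum_eq_zero_iff_of_nonneg fun o _ =>
      (Matrix.posSemidef_self_mul_conjTranspose _).trace_nonneg] at hsum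
  rw [hdual]
  exact Matrix.trace_mul_conjTranspose_self_eq_zero_iff.mp (hsum o (Finset.mem_univ o))

theorem HasDualFlag.primitiveIdempotent_mul_dualAdjMatrix_mul_of_lt (hφ : HasDualFlag Γ D φ θ)
    (hΓ : Γ.IsDistanceRegularWith D p) (hj : j ∈ Finset.range (D + 1)) (hij : i + 1 < j) (o : X) :
    primitiveIdempotent Γ D θ i * dualAdjMatrix Γ φ o * primitiveIdempotent Γ D θ j = 0 := by
  have h := congrArg Matrix.transpose (hφ.primitiveIdempotent_mul_dualAdjMatrix_mul hΓ hj hij o)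
  rwa [Matrix.transpose_mul, Matrix.transpose_mul, dualAdjMatrix, Matrix.diagonal_transpose,
    primitiveIdempotent, primitiveIdempotent, transpose_aeval_realDistMatrix,
    transpose_aeval_realDistMatrix, Matrix.transpose_zero, ← mul_assoc] at h

theorem HasDualFlag.aeval_mul_mul_aeval (hφ : HasDualFlag Γ D φ θ)
    (hΓ : Γ.IsDistanceRegularWith D p) (f g : ℝ[X]) (S : Matrix X X ℝ) :
    aeval (realDistMatrix Γ 1) f * S * aeval (realDistMatrix Γ 1) g =
      ∑ m ∈ Finset.range (D + 1), ∑ n ∈ Finset.range (D + 1), (f.eval (θ m) * g.eval (θ n)) •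
        (primitiveIdempotent Γ D θ m * S * primitiveIdempotent Γ D θ n) := by
  rw [hφ.aeval_eq_sum_primitiveIdempotent hΓ f, hφ.aeval_eq_sum_primitiveIdempotent hΓ g,
    Finset.sum_mul, Finset.sum_mul_sum]
  refine Finset.sum_congr rfl fun m _ => Finset.sum_congr rfl fun n _ => ?_
  rw [smul_mul_assoc, smul_mul_assoc, mul_smul_comm, smul_smul]

-- Since `E_m A* E_n` vanishes for `|m - n| > 1`, it suffices that
-- `q(θ_{n+1}) - q(θ_n) = f(θ_n) g(θ_{n+1}) - g(θ_n) f(θ_{n+1})`.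
theorem HasDualFlag.exists_commutator_eq (hφ : HasDualFlag Γ D φ θ)
    (hΓ : Γ.IsDistanceRegularWith D p) (f g : ℝ[X]) :
    ∃ q : ℝ[X], ∀ o,
      aeval (realDistMatrix Γ 1) f * dualAdjMatrix Γ φ o * aeval (realDistMatrix Γ 1) g -
        aeval (realDistMatrix Γ 1) g * dualAdjMatrix Γ φ o * aeval (realDistMatrix Γ 1) f =
      dualAdjMatrix Γ φ o * aeval (realDistMatrix Γ 1) q -
        aeval (realDistMatrix Γ 1) q * dualAdjMatrix Γ φ o := by
  obtain ⟨h, hsucc⟩ : ∃ h : ℕ → ℝ, ∀ n, h (n + 1) =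
      h n + (f.eval (θ n) * g.eval (θ (n + 1)) - g.eval (θ n) * f.eval (θ (n + 1))) :=
    ⟨fun n => ∑ l ∈ Finset.range n,
      (f.eval (θ l) * g.eval (θ (l + 1)) - g.eval (θ l) * f.eval (θ (l + 1))),
      fun n => Finset.sum_range_succ _ _⟩
  obtain ⟨q, hq⟩ : ∃ q : ℝ[X], ∀ n ∈ Finset.range (D + 1), q.eval (θ n) = h n :=
    ⟨Lagrange.interpolate (Finset.range (D + 1)) θ h,
      fun n hn => Lagrange.eval_interpolate_at_node h (hφ.injOn_eigenvalue hΓ) hn⟩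
  refine ⟨q, fun o => ?_⟩
  have hleft := hφ.aeval_mul_mul_aeval hΓ 1 q (dualAdjMatrix Γ φ o)
  have hright := hφ.aeval_mul_mul_aeval hΓ q 1 (dualAdjMatrix Γ φ o)
  rw [map_one, one_mul] at hleft
  rw [map_one, mul_one] at hright
  simp only [hleft, hright, hφ.aeval_mul_mul_aeval hΓ, ← Finset.sum_sub_distrib, ← sub_smul]
  refine Finset.sum_congr rfl fun m hm => Finset.sum_congr rfl fun n hn => ?_
  rw [hq m hm, hq n hn, eval_one, eval_one, one_mul, mul_one]
  rcases lt_trichotomy (m + 1) n with hmn | rfl | hmn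
  · rw [hφ.primitiveIdempotent_mul_dualAdjMatrix_mul_of_lt hΓ hn hmn, smul_zero, smul_zero]
  · rw [hsucc, add_sub_cancel_left, mul_comm (g.eval _)]
  rcases lt_trichotomy (n + 1) m with hnm | rfl | hnm
  · rw [hφ.primitiveIdempotent_mul_dualAdjMatrix_mul hΓ hm hnm, smul_zero, smul_zero]
  · congr 1
    rw [hsucc]
    ring
  · obtain rfl : m = n := by omega
    rw [mul_comm, sub_self, sub_self]

theorem mul_diagonal_mul_apply (B C : Matrix X X ℝ) (f : X → ℝ) (y z : X) :
    (B * Matrix.diagonal f * C) y z = ∑ u, B y u * f u * C u z := by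
  rw [Matrix.mul_apply]
  simp only [Matrix.mul_diagonal]

theorem HasDualFlag.exists_aeval_eq_realDistMatrix (hφ : HasDualFlag Γ D φ θ)
    (hΓ : Γ.IsDistanceRegularWith D p) (i : ℕ) :
    ∃ q : ℝ[X], aeval (realDistMatrix Γ 1) q = realDistMatrix Γ i :=
  hφ.exists_aeval_eq hΓ (of_dist_mem_polySpace hΓ hφ.injOn fun n => if n = i then 1 else 0)

theorem HasDualFlag.exists_commutator_realDistMatrix_eq (hφ : HasDualFlag Γ D φ θ)
    (hΓ : Γ.IsDistanceRegularWith D p) (i j : ℕ) :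
    ∃ h : ℕ → ℝ, ∀ o,
      realDistMatrix Γ i * dualAdjMatrix Γ φ o * realDistMatrix Γ j -
        realDistMatrix Γ j * dualAdjMatrix Γ φ o * realDistMatrix Γ i =
      dualAdjMatrix Γ φ o * Matrix.of (fun y z => h (Γ.dist y z)) -
        Matrix.of (fun y z => h (Γ.dist y z)) * dualAdjMatrix Γ φ o := by
  obtain ⟨f, hf⟩ := hφ.exists_aeval_eq_realDistMatrix hΓ i
  obtain ⟨g, hg⟩ := hφ.exists_aeval_eq_realDistMatrix hΓ j
  obtain ⟨q, hq⟩ := hφ.exists_commutator_eq hΓ f g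
  obtain ⟨R, -, hR⟩ := hφ.aeval_mul_mem q (one_mem_polySpace hΓ hφ.injOn)
  rw [mul_one] at hR
  refine ⟨fun n => R.eval (φ n), fun o => ?_⟩
  rw [← hf, ← hg, hq o, ← hR]
  rfl

omit [DecidableEq X] in
/-- The balanced set condition, with the two sums of idempotent entries rewritten as sums of dual
eigenvalues. -/
theorem HasDualFlag.exists_balanced (hφ : HasDualFlag Γ D φ θ)
    (hΓ : Γ.IsDistanceRegularWith D p) (i j : ℕ) :
    ∃ h : ℕ → ℝ, ∀ o y z,
      ∑ u with Γ.dist y u = i ∧ Γ.dist z u = j, φ (Γ.dist o u) -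
        ∑ u with Γ.dist y u = j ∧ Γ.dist z u = i, φ (Γ.dist o u) =
      h (Γ.dist y z) * (φ (Γ.dist o y) - φ (Γ.dist o z)) := by
  classical
  obtain ⟨h, hcomm⟩ := hφ.exists_commutator_realDistMatrix_eq hΓ i j
  have hentry : ∀ (m n : ℕ) (o y z : X),
      (realDistMatrix Γ m * dualAdjMatrix Γ φ o * realDistMatrix Γ n) y z =
        ∑ u with Γ.dist y u = m ∧ Γ.dist z u = n, φ (Γ.dist o u) := by
    intro m n o y z
    rw [dualAdjMatrix, mul_diagonal_mul_apply, Finset.sum_filter]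
    refine Finset.sum_congr rfl fun u _ => ?_
    rw [realDistMatrix_apply, realDistMatrix_apply, Γ.dist_comm (u := u), ite_and]
    split_ifs <;> simp only [one_mul, mul_one, mul_zero, zero_mul]
  refine ⟨h, fun o y z => ?_⟩
  have hyz := congrFun (congrFun (hcomm o) y) z
  rw [Matrix.sub_apply, Matrix.sub_apply, hentry, hentry, dualAdjMatrix, Matrix.diagonal_mul,
    Matrix.mul_diagonal, Matrix.of_apply] at hyz
  rw [hyz]
  ring

end PrimitiveIdempotents

section Kites

variable {X : Type*} {Γ : SimpleGraph X} {D : ℕ} {p : ℕ → ℕ → ℕ → ℕ} {b α β : ℝ}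

theorem sum_comp_of_mem_three {s : Finset X} {d : X → ℕ} {n : ℕ} (φ : ℕ → ℝ)
    (hd : ∀ v ∈ s, d v = n ∨ d v = n + 1 ∨ d v = n + 2) :
    ∑ v ∈ s, φ (d v) = s.card * φ (n + 2) +
      (s.filter fun v => d v = n).card * (φ n - φ (n + 2)) +
      (s.filter fun v => d v = n + 1).card * (φ (n + 1) - φ (n + 2)) := by
  have hv : ∀ v ∈ s, φ (d v) = φ (n + 2) + (if d v = n then φ n - φ (n + 2) else 0) +
      (if d v = n + 1 then φ (n + 1) - φ (n + 2) else 0) := by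
    intro v hv
    rcases hd v hv with h | h | h <;> simp [h]
  rw [Finset.sum_congr rfl hv, Finset.sum_add_distrib, Finset.sum_add_distrib,
    ← Finset.sum_filter, ← Finset.sum_filter, Finset.sum_const, Finset.sum_const,
    Finset.sum_const, nsmul_eq_mul, nsmul_eq_mul, nsmul_eq_mul]

-- Eliminating `r` and clearing denominators leaves `(1 - t³) (t - t²) (s t - κ) = 0`, `t = b⁻¹`.
theorem eq_mul_of_balanced (hb0 : b ≠ 0) (hb1 : b ≠ 1) {c₂ c₃ s κ r : ℝ}
    (hc₂ : c₂ = (1 + b) * (1 + α)) (hc₃ : c₃ = (1 + b + b ^ 2) * (1 + α * (1 + b)))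
    (h₂ : c₃ * b⁻¹ ^ 3 + c₂ * (b⁻¹ ^ 1 - b⁻¹ ^ 3) + s * (b⁻¹ ^ 2 - b⁻¹ ^ 3) -
      (c₃ * b⁻¹ ^ 2 + 1 * (b⁻¹ ^ 0 - b⁻¹ ^ 2) + κ * (b⁻¹ ^ 1 - b⁻¹ ^ 2)) =
      r * (b⁻¹ ^ 2 - b⁻¹ ^ 1))
    (h₃ : c₃ * b⁻¹ ^ 1 - c₃ * b⁻¹ ^ 2 = r * (b⁻¹ ^ 0 - b⁻¹ ^ 3)) : s = b * κ := by
  have hbt : b * b⁻¹ = 1 := mul_inv_cancel₀ hb0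
  have ht0 : b⁻¹ ≠ 0 := inv_ne_zero hb0
  have ht1 : 1 - b⁻¹ ≠ 0 := sub_ne_zero.mpr fun h => hb1 (inv_eq_one.mp h.symm)
  generalize b⁻¹ = t at *
  have htc₂ : t * c₂ = (t + 1) * (1 + α) := by
    rw [hc₂]
    linear_combination (1 + α) * hbt
  have htc₃ : t ^ 3 * c₃ = (1 + t + t ^ 2) * (t + α * (t + 1)) := by
    have h31 : t ^ 2 * (1 + b + b ^ 2) = 1 + t + t ^ 2 := by
      linear_combination (t + b * t + 1) * hbt
    have h32 : t * (1 + α * (1 + b)) = t + α * (t + 1) := by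
      linear_combination α * hbt
    rw [hc₃, ← h31, ← h32]
    ring
  have hprod : (1 - t ^ 3) * ((t - t ^ 2) * (s * t - κ)) = 0 := by
    linear_combination (1 - t ^ 3) * h₂ + (t - t ^ 2) * h₃ -
      (1 - t ^ 2) * (1 - t ^ 3) * htc₂ + (1 - t ^ 2) * (1 - t) * htc₃
  have hcube : 1 - t ^ 3 ≠ 0 := by
    rw [show 1 - t ^ 3 = (1 - t) * (1 + t + t ^ 2) by ring]
    exact mul_ne_zero ht1 (by nlinarith [sq_nonneg (t + 1)])
  have hsq : t - t ^ 2 ≠ 0 := by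
    rw [show t - t ^ 2 = t * (1 - t) by ring]
    exact mul_ne_zero ht0 ht1
  have hst := (mul_eq_zero.mp ((mul_eq_zero.mp hprod).resolve_left hcube)).resolve_left hsq
  linear_combination b * hst - s * hbt

variable [Fintype X] {x y u w : X}

theorem card_dist_eq_pred_eq_cNum (hΓ : Γ.IsDistanceRegularWith D p) {i : ℕ} (h1 : 1 ≤ i)
    (hi : i ≤ D) (hxy : Γ.dist x y = 1) (hxw : Γ.dist x w = i + 1) (hyw : Γ.dist y w = i) :
    ((Finset.univ.filter fun v => Γ.dist w v = 1 ∧ Γ.dist x v = i).filter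
      fun v => Γ.dist y v = i - 1).card = cNum p i := by
  rw [cNum, ← card_dist_eq_dist_eq hΓ (by omega) (by omega) (Γ.dist_comm.trans hyw),
    Finset.filter_filter]
  congr 1
  ext v
  have hxvw := hΓ.connected.dist_triangle (u := x) (v := v) (w := w)
  have hxyv := hΓ.connected.dist_triangle (u := x) (v := y) (w := v)
  rw [Γ.dist_comm (u := v) (v := w)] at hxvw
  simp only [Finset.mem_filter, Finset.mem_univ, true_and]
  omega

omit [Fintype X] in
theorem card_filter_dist_eq_zero (hΓ : Γ.Connected) {s : Finset X} (hy : y ∈ s) :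
    (s.filter fun v => Γ.dist y v = 0).card = 1 := by
  refine Finset.card_eq_one.mpr ⟨y, Finset.ext fun v => ?_⟩
  rw [Finset.mem_filter, hΓ.dist_eq_zero_iff, Finset.mem_singleton, eq_comm,
    and_iff_right_of_imp]
  rintro rfl
  exact hy

theorem card_dist_eq_two_eq_mul_card (hΓ : Γ.IsDistanceRegularWith D p)
    (hcl : HasClassicalParameters p D b α β) (hD : 3 ≤ D) (hb0 : b ≠ 0) (hb1 : |b| ≠ 1)
    (hxy : Γ.dist x y = 1) (hxw : Γ.dist x w = 3) (hyw : Γ.dist y w = 2) :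
    (((Finset.univ.filter fun v => Γ.dist w v = 1 ∧ Γ.dist x v = 2).filter
        fun v => Γ.dist y v = 2).card : ℝ) =
      b * ((Finset.univ.filter fun v => Γ.dist w v = 2 ∧ Γ.dist x v = 1).filter
        fun v => Γ.dist y v = 1).card := by
  have hwx : Γ.dist w x = 3 := Γ.dist_comm.trans hxw
  have hwy : Γ.dist w y = 2 := Γ.dist_comm.trans hyw
  have hyx : Γ.dist y x = 1 := Γ.dist_comm.trans hxy
  obtain ⟨θ, hφ⟩ := exists_hasDualFlag hΓ hcl (by omega) hb0 hb1
  obtain ⟨r, hr⟩ := hφ.exists_balanced hΓ 1 2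
  have hy := hr y w x
  have hw := hr w w x
  set F := Finset.univ.filter fun v => Γ.dist w v = 1 ∧ Γ.dist x v = 2
  set G := Finset.univ.filter fun v => Γ.dist w v = 2 ∧ Γ.dist x v = 1 with hG
  have hmemF : ∀ v ∈ F, Γ.dist w v = 1 ∧ Γ.dist x v = 2 := fun v hv => (Finset.mem_filter.mp hv).2
  have hmemG : ∀ v ∈ G, Γ.dist w v = 2 ∧ Γ.dist x v = 1 := fun v hv => (Finset.mem_filter.mp hv).2
  have hFcard : F.card = cNum p 3 := card_dist_eq_dist_eq hΓ (by omega) (by omega) hwx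
  have hGcard : G.card = cNum p 3 := by
    rw [cNum, ← card_dist_eq_dist_eq hΓ (by omega) (by omega) hxw]
    simp only [hG, and_comm]
  have hF1 : (F.filter fun v => Γ.dist y v = 1).card = cNum p 2 :=
    card_dist_eq_pred_eq_cNum hΓ (by omega) (by omega) hxy hxw hyw
  have hG0 : (G.filter fun v => Γ.dist y v = 0).card = 1 :=
    card_filter_dist_eq_zero hΓ.connected (Finset.mem_filter.mpr ⟨Finset.mem_univ y, hwy, hxy⟩)
  rw [sum_comp_of_mem_three (d := Γ.dist y) (n := 1) (fun i => b⁻¹ ^ i) fun v hv => by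
      have := dist_cases_of_dist_eq_one hΓ.connected y (hmemF v hv).1
      omega,
    sum_comp_of_mem_three (d := Γ.dist y) (n := 0) (fun i => b⁻¹ ^ i) fun v hv => by
      have := dist_cases_of_dist_eq_one hΓ.connected y (hmemG v hv).2
      omega, hFcard, hGcard, hF1, hG0, hwx, hyw, hyx] at hy
  rw [Finset.sum_eq_card_nsmul fun v hv => congrArg (b⁻¹ ^ ·) (hmemF v hv).1,
    Finset.sum_eq_card_nsmul fun v hv => congrArg (b⁻¹ ^ ·) (hmemG v hv).1, nsmul_eq_mul,
    nsmul_eq_mul, hFcard, hGcard, Γ.dist_self, hwx] at hw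
  have hc₂ := hcl.c_eq 2 (by omega) (by omega)
  have hc₃ := hcl.c_eq 3 (by omega) hD
  simp only [gaussBracket, Finset.sum_range_succ, Finset.sum_range_zero, Nat.add_one_sub_one,
    pow_zero, pow_one, zero_add, mul_one] at hc₂ hc₃
  exact eq_mul_of_balanced hb0 (fun h => hb1 (by rw [h, abs_one])) hc₂ hc₃
    (by exact_mod_cast hy) hw

omit [Fintype X] in
theorem not_isKite_three [Finite X] (hΓ : Γ.IsDistanceRegularWith D p)
    (hcl : HasClassicalParameters p D b α β) (hD : 3 ≤ D) (hb : b < -1) :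
    ¬ Γ.IsKite 3 x y u w := by
  have := Fintype.ofFinite X
  rintro ⟨hxy, hxu, hyu, hxw, hyw, huw⟩
  have hcard := card_dist_eq_two_eq_mul_card hΓ hcl hD (by linarith)
    (by rw [abs_of_neg (by linarith)]; linarith) (dist_eq_one_iff_adj.mpr hxy) hxw hyw
  refine hcard.not_gt ((mul_neg_of_neg_of_pos (by linarith) ?_).trans_le (Nat.cast_nonneg _))
  refine Nat.cast_pos.mpr (Finset.card_pos.mpr ⟨u, ?_⟩)
  simp only [Finset.mem_filter, Finset.mem_univ, true_and]
  exact ⟨⟨Γ.dist_comm.trans huw, dist_eq_one_iff_adj.mpr hxu⟩, dist_eq_one_iff_adj.mpr hyu⟩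

omit [Fintype X] in
theorem not_isKite_two [Finite X] (hΓ : Γ.IsDistanceRegularWith D p)
    (hcl : HasClassicalParameters p D b α β) (hD : 3 ≤ D) (hb : b < -1) :
    ¬ Γ.IsKite 2 x y u w := by
  have := Fintype.ofFinite X
  rintro ⟨hxy, hxu, hyu, hxw, hyw, huw⟩
  obtain ⟨v, hv⟩ : (Finset.univ.filter fun v => Γ.dist w v = 1 ∧ Γ.dist x v = 3).Nonempty := by
    rw [← Finset.card_pos, card_dist_eq_dist_eq hΓ (by omega) hD (Γ.dist_comm.trans hxw)]
    exact bNum_pos hΓ hD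
  obtain ⟨hwv, hxv⟩ := (Finset.mem_filter.mp hv).2
  have hdist : ∀ t, Γ.Adj x t → Γ.dist t w = 1 → Γ.dist t v = 2 := by
    intro t hxt htw
    have h1 := hΓ.connected.dist_triangle (u := x) (v := t) (w := v)
    have h2 := hΓ.connected.dist_triangle (u := t) (v := w) (w := v)
    rw [dist_eq_one_iff_adj.mpr hxt] at h1
    omega
  exact not_isKite_three hΓ hcl hD hb ⟨hxy, hxu, hyu, hxv, hdist y hxy hyw, hdist u hxu huw⟩

omit [Fintype X] in
theorem adj_trans_of_adj [Finite X] (hΓ : Γ.IsDistanceRegularWith D p)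
    (hcl : HasClassicalParameters p D b α β) (hD : 3 ≤ D) (hb : b < -1)
    (hxy : Γ.Adj x y) (hxu : Γ.Adj x u) (hxw : Γ.Adj x w) (hyu : Γ.Adj y u) (huw : Γ.Adj u w)
    (hne : y ≠ w) : Γ.Adj y w := by
  by_contra hyw
  have h1 := hΓ.connected.one_lt_dist_of_ne_of_not_adj hne hyw
  have h2 := hΓ.connected.dist_triangle (u := y) (v := u) (w := w)
  rw [dist_eq_one_iff_adj.mpr hyu, dist_eq_one_iff_adj.mpr huw] at h2
  exact not_isKite_two hΓ hcl hD hb ⟨hxy.symm, hyu, hxu, by omega,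
    dist_eq_one_iff_adj.mpr hxw, dist_eq_one_iff_adj.mpr huw⟩

end Kites

section Triples

variable {K Q : Type*} [Field K] [AddCommGroup Q] [Module K Q] {φ : ℕ → K} {N : ℕ}

theorem eq_zero_of_sum_eq_zero_of_sum_smul_eq_zero (hφ : Set.InjOn φ (Set.Iio N)) {f : ℕ → Q}
    {a c : ℕ} (hf : ∀ i, f i ≠ 0 → i < N ∧ (i = a ∨ i = c))
    (hsum : ∑ i ∈ Finset.range N, f i = 0) (hsmul : ∑ i ∈ Finset.range N, φ i • f i = 0)
    (i : ℕ) : f i = 0 := by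
  by_contra hi
  have hiN := Finset.mem_range.mpr (hf i hi).1
  obtain ⟨m, hmi, hm⟩ : ∃ m, m ≠ i ∧ f m ≠ 0 := by
    by_contra! h
    exact hi ((Finset.sum_eq_single_of_mem i hiN fun m _ hmi => h m hmi).symm.trans hsum)
  have hsub : ∑ n ∈ Finset.range N, (φ n - φ m) • f n = 0 := by
    simp only [sub_smul, Finset.sum_sub_distrib, ← Finset.smul_sum, hsum, hsmul, smul_zero,
      sub_zero]
  rw [Finset.sum_eq_single_of_mem i hiN fun n _ hni => ?_] at hsub
  · have hφi := sub_eq_zero.mp ((smul_eq_zero.mp hsub).resolve_right hi)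
    exact hmi (hφ (hf i hi).1 (hf m hm).1 hφi).symm
  · by_cases hn : f n = 0
    · rw [hn, smul_zero]
    · have hi' := hf i hi
      have hm' := hf m hm
      have hn' := hf n hn
      rw [show n = m by omega, sub_self, zero_smul]

theorem eq_zero_of_triple_relations (hφ : Set.InjOn φ (Set.Iio N)) {z : ℕ → ℕ → ℕ → Q}
    (hz : ∀ l i j, z l i j ≠ 0 →
      i < N ∧ j < N ∧ l ≤ i + 1 ∧ i ≤ l + 1 ∧ i ≤ j + 1 ∧ j ≤ i + 1)
    (hsum : ∀ l j, ∑ i ∈ Finset.range N, z l i j = 0)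
    (hsmul : ∀ l j, ∑ i ∈ Finset.range N, φ i • z l i j = 0)
    (hsum_right : ∀ l i, ∑ j ∈ Finset.range N, z l i j = 0) (l i j : ℕ) : z l i j = 0 := by
  have hne : ∀ l i j, l ≠ j → z l i j = 0 := by
    intro l i j hlj
    refine eq_zero_of_sum_eq_zero_of_sum_smul_eq_zero (a := min l j) (c := min l j + 1) hφ ?_
      (hsum l j) (hsmul l j) i
    intro m hm
    have := hz l m j hm
    omega
  rcases ne_or_eq l j with hlj | rfl
  · exact hne l i j hlj
  · rw [← hsum_right l i, eq_comm]
    refine Finset.sum_eq_single l (fun j _ hjl => hne l i j hjl.symm) fun hl => ?_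
    by_contra h
    exact hl (Finset.mem_range.mpr (hz l i l h).2.1)

end Triples

section Terwilliger

variable {X : Type*} {Γ : SimpleGraph X} {D : ℕ} {p : ℕ → ℕ → ℕ → ℕ} {x : X} {v : X → ℂ}
  {i j l : ℕ}

theorem distMatrix_apply (i : ℕ) (y z : X) :
    Γ.distMatrix i y z = if Γ.dist y z = i then 1 else 0 := rfl

theorem distMatrix_zero [DecidableEq X] (hΓ : Γ.Connected) : Γ.distMatrix 0 = 1 := by
  ext y z
  simp only [distMatrix_apply, Matrix.one_apply, hΓ.dist_eq_zero_iff]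

theorem distMatrix_eq_zero [Finite X] (hΓ : Γ.IsDistanceRegularWith D p) (hi : D < i) :
    Γ.distMatrix i = 0 := by
  ext y z
  have := dist_le_diameter hΓ y z
  rw [distMatrix_apply, if_neg (by omega), Matrix.zero_apply]

theorem sum_smul_distMatrix [Finite X] (hΓ : Γ.IsDistanceRegularWith D p) (f : ℕ → ℂ) :
    ∑ i ∈ Finset.range (D + 1), f i • Γ.distMatrix i = Matrix.of fun y z => f (Γ.dist y z) := by
  ext y z
  have hyz : Γ.dist y z < D + 1 := Nat.lt_succ_of_le (dist_le_diameter hΓ y z)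
  rw [Matrix.sum_apply]
  simp only [Matrix.smul_apply, distMatrix_apply, smul_eq_mul, mul_ite, mul_one, mul_zero,
    Finset.sum_ite_eq, Finset.mem_range, hyz, if_true, Matrix.of_apply]

theorem of_dist_mem_boseMesner [Finite X] (hΓ : Γ.IsDistanceRegularWith D p) (f : ℕ → ℂ) :
    Matrix.of (fun y z => f (Γ.dist y z)) ∈ Γ.boseMesner := by
  rw [← sum_smul_distMatrix hΓ]
  refine Submodule.sum_mem _ fun i hi => Submodule.smul_mem _ _ (Submodule.subset_span ⟨i, ?_, rfl⟩)
  rw [hΓ.diam_eq]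
  exact Nat.lt_succ_iff.mp (Finset.mem_range.mp hi)

theorem distMatrix_mem_boseMesner [Finite X] (hΓ : Γ.IsDistanceRegularWith D p) (i : ℕ) :
    Γ.distMatrix i ∈ Γ.boseMesner :=
  of_dist_mem_boseMesner hΓ fun n => if n = i then 1 else 0

theorem distMatrix_mul_mem_boseMesner [Fintype X] (hΓ : Γ.IsDistanceRegularWith D p) (i j : ℕ) :
    Γ.distMatrix i * Γ.distMatrix j ∈ Γ.boseMesner := by
  rcases lt_or_ge D i with hi | hi
  · rw [distMatrix_eq_zero hΓ hi, zero_mul]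
    exact zero_mem _
  rcases lt_or_ge D j with hj | hj
  · rw [distMatrix_eq_zero hΓ hj, mul_zero]
    exact zero_mem _
  convert of_dist_mem_boseMesner hΓ fun h => (p h i j : ℂ) using 1
  ext y z
  rw [Matrix.mul_apply, Matrix.of_apply, ← card_dist_eq_dist_eq hΓ hi hj rfl, Finset.card_filter,
    Nat.cast_sum]
  refine Finset.sum_congr rfl fun u _ => ?_
  rw [distMatrix_apply, distMatrix_apply, Γ.dist_comm (u := u), ite_and]
  split_ifs <;> norm_num

theorem mapMatrix_ofReal_realDistMatrix [Fintype X] [DecidableEq X] (i : ℕ) :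
    Complex.ofRealHom.mapMatrix (realDistMatrix Γ i) = Γ.distMatrix i := by
  ext y z
  rw [RingHom.mapMatrix_apply, Matrix.map_apply, realDistMatrix_apply, distMatrix_apply,
    apply_ite Complex.ofRealHom, map_one, map_zero]

variable [DecidableEq X]

theorem dualIdempotent_eq_zero [Finite X] (hΓ : Γ.IsDistanceRegularWith D p) (hi : D < i) (x : X) :
    Γ.dualIdempotent x i = 0 := by
  rw [dualIdempotent, ← Matrix.diagonal_zero]
  refine congrArg Matrix.diagonal (funext fun y => if_neg ?_)
  have := dist_le_diameter hΓ x y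
  omega

theorem sum_smul_dualIdempotent [Finite X] (hΓ : Γ.IsDistanceRegularWith D p) (x : X) (f : ℕ → ℂ) :
    ∑ i ∈ Finset.range (D + 1), f i • Γ.dualIdempotent x i =
      Matrix.diagonal fun u => f (Γ.dist x u) := by
  ext y z
  have hy : Γ.dist x y < D + 1 := Nat.lt_succ_of_le (dist_le_diameter hΓ x y)
  rw [Matrix.sum_apply]
  simp only [dualIdempotent, Matrix.smul_apply, Matrix.diagonal_apply, smul_eq_mul]
  split_ifs
  · simp only [mul_ite, mul_one, mul_zero, Finset.sum_ite_eq, Finset.mem_range, hy, if_true]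
  · simp only [mul_zero, Finset.sum_const_zero]

theorem sum_dualIdempotent [Finite X] (hΓ : Γ.IsDistanceRegularWith D p) (x : X) :
    ∑ i ∈ Finset.range (D + 1), Γ.dualIdempotent x i = 1 := by
  simpa only [one_smul, Matrix.diagonal_one] using sum_smul_dualIdempotent hΓ x fun _ => 1

variable [Fintype X]

theorem dualIdempotent_mulVec_apply (i : ℕ) (v : X → ℂ) (w : X) :
    (Γ.dualIdempotent x i *ᵥ v) w = if Γ.dist x w = i then v w else 0 := by
  rw [dualIdempotent, Matrix.mulVec_diagonal, ite_mul, one_mul, zero_mul]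

theorem dualIdempotent_mulVec_eq_zero (h : ∀ w, Γ.dist x w = i → v w = 0) :
    Γ.dualIdempotent x i *ᵥ v = 0 := by
  ext w
  rw [dualIdempotent_mulVec_apply, Pi.zero_apply]
  split_ifs with hw
  exacts [h w hw, rfl]

theorem dualIdempotent_mul_dualIdempotent (i j : ℕ) :
    Γ.dualIdempotent x i * Γ.dualIdempotent x j =
      if i = j then Γ.dualIdempotent x i else 0 := by
  rw [dualIdempotent, dualIdempotent, Matrix.diagonal_mul_diagonal]
  split_ifs with hij
  · simp only [hij, mul_ite, mul_one, mul_zero]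
    refine congrArg Matrix.diagonal (funext fun y => ?_)
    split_ifs <;> rfl
  · rw [← Matrix.diagonal_zero]
    refine congrArg Matrix.diagonal (funext fun y => ?_)
    split_ifs <;> first | omega | simp only [mul_zero, zero_mul]

theorem distMatrix_mem_terwilligerAlgebra (hΓ : Γ.IsDistanceRegularWith D p) (x : X) (i : ℕ) :
    Γ.distMatrix i ∈ Γ.terwilligerAlgebra x :=
  Algebra.subset_adjoin (Or.inl (distMatrix_mem_boseMesner hΓ i))

theorem dualIdempotent_mem_terwilligerAlgebra (hΓ : Γ.IsDistanceRegularWith D p) (x : X) (i : ℕ) :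
    Γ.dualIdempotent x i ∈ Γ.terwilligerAlgebra x := by
  rcases lt_or_ge D i with hi | hi
  · rw [dualIdempotent_eq_zero hΓ hi]
    exact zero_mem _
  · exact Algebra.subset_adjoin (Or.inr (Submodule.subset_span ⟨i, hΓ.diam_eq.symm ▸ hi, rfl⟩))

theorem terwilligerAlgebra_le {S : Subalgebra ℂ (Matrix X X ℂ)}
    (hA : ∀ i, Γ.distMatrix i ∈ S) (hE : ∀ i, Γ.dualIdempotent x i ∈ S) :
    Γ.terwilligerAlgebra x ≤ S := by
  refine Algebra.adjoin_le (Set.union_subset ?_ ?_)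
  · refine (Submodule.span_le (p := Subalgebra.toSubmodule S)).mpr ?_
    rintro _ ⟨i, -, rfl⟩
    exact hA i
  · refine (Submodule.span_le (p := Subalgebra.toSubmodule S)).mpr ?_
    rintro _ ⟨i, -, rfl⟩
    exact hE i

theorem HasDualFlag.distMatrix_mem {φ θ : ℕ → ℝ} (hφ : HasDualFlag Γ D φ θ)
    (hΓ : Γ.IsDistanceRegularWith D p) {S : Subalgebra ℂ (Matrix X X ℂ)}
    (h : Γ.distMatrix 1 ∈ S) (i : ℕ) : Γ.distMatrix i ∈ S := by
  obtain ⟨q, hq⟩ := hφ.exists_aeval_eq_realDistMatrix hΓ i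
  rw [← mapMatrix_ofReal_realDistMatrix, ← hq, Polynomial.aeval_eq_sum_range, map_sum]
  refine sum_mem fun n _ => ?_
  have hmap : Complex.ofRealHom.mapMatrix (q.coeff n • realDistMatrix Γ 1 ^ n) =
      (q.coeff n : ℂ) • Γ.distMatrix 1 ^ n := by
    rw [← mapMatrix_ofReal_realDistMatrix, ← map_pow]
    ext y z
    simp only [RingHom.mapMatrix_apply, Matrix.map_apply, Matrix.smul_apply, smul_eq_mul, map_mul,
      Complex.ofRealHom_eq_coe]
  rw [hmap]
  exact S.smul_mem (pow_mem h n) _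

theorem HasDualFlag.isTModule {φ θ : ℕ → ℝ} (hφ : HasDualFlag Γ D φ θ)
    (hΓ : Γ.IsDistanceRegularWith D p) {W : Submodule ℂ (X → ℂ)}
    (hA : ∀ w ∈ W, Γ.distMatrix 1 *ᵥ w ∈ W)
    (hE : ∀ i, ∀ w ∈ W, Γ.dualIdempotent x i *ᵥ w ∈ W) : Γ.IsTModule x W := by
  let S : Subalgebra ℂ (Matrix X X ℂ) :=
    { carrier := {B | ∀ w ∈ W, B *ᵥ w ∈ W}
      mul_mem' := fun hB hC w hw => by
        rw [← Matrix.mulVec_mulVec]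
        exact hB _ (hC w hw)
      add_mem' := fun hB hC w hw => by
        rw [Matrix.add_mulVec]
        exact add_mem (hB w hw) (hC w hw)
      algebraMap_mem' := fun c w hw => by
        rw [Algebra.algebraMap_eq_smul_one, Matrix.smul_mulVec, Matrix.one_mulVec]
        exact W.smul_mem c hw }
  exact fun B hB => terwilligerAlgebra_le (S := S) (hφ.distMatrix_mem hΓ hA) hE hB

end Terwilliger

section LocalSpace

variable {X : Type*} [Fintype X] [DecidableEq X] {Γ : SimpleGraph X} {D : ℕ}
  {p : ℕ → ℕ → ℕ → ℕ} {x : X} {η : ℂ} {v : X → ℂ} {φ θ : ℕ → ℝ} {i j l : ℕ}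

/-- The vectors of `E*_1 V` that are orthogonal to the all-ones vector and are eigenvectors of the
local graph for the eigenvalue `η`; the orthogonality is expressed as `E*_0 A v = 0`. -/
noncomputable def localSpace (Γ : SimpleGraph X) (x : X) (η : ℂ) : Submodule ℂ (X → ℂ) :=
  LinearMap.ker (Γ.dualIdempotent x 1 - 1).mulVecLin ⊓
    LinearMap.ker (Γ.dualIdempotent x 0 * Γ.distMatrix 1).mulVecLin ⊓
    LinearMap.ker (Γ.dualIdempotent x 1 * Γ.distMatrix 1 * Γ.dualIdempotent x 1 -
      η • (1 : Matrix X X ℂ)).mulVecLin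

theorem mem_localSpace : v ∈ localSpace Γ x η ↔
    Γ.dualIdempotent x 1 *ᵥ v = v ∧ (Γ.dualIdempotent x 0 * Γ.distMatrix 1) *ᵥ v = 0 ∧
      (Γ.dualIdempotent x 1 * Γ.distMatrix 1 * Γ.dualIdempotent x 1) *ᵥ v = η • v := by
  simp only [localSpace, Submodule.mem_inf, LinearMap.mem_ker, Matrix.mulVecLin_apply,
    Matrix.sub_mulVec, Matrix.one_mulVec, Matrix.smul_mulVec, sub_eq_zero, and_assoc]

theorem eq_zero_of_mem_localSpace (hv : v ∈ localSpace Γ x η) {w : X} (hw : Γ.dist x w ≠ 1) :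
    v w = 0 := by
  have h := congrFun (mem_localSpace.mp hv).1 w
  rwa [dualIdempotent_mulVec_apply, if_neg hw, eq_comm] at h

theorem dualIdempotent_one_mulVec_adj_mulVec (hv : v ∈ localSpace Γ x η) :
    Γ.dualIdempotent x 1 *ᵥ (Γ.distMatrix 1 *ᵥ v) = η • v := by
  have h := (mem_localSpace.mp hv).2.2
  rwa [← Matrix.mulVec_mulVec, (mem_localSpace.mp hv).1, ← Matrix.mulVec_mulVec] at h

theorem sum_eq_zero_of_mem_localSpace (hv : v ∈ localSpace Γ x η) : ∑ w, v w = 0 := by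
  have h := congrFun (mem_localSpace.mp hv).2.1 x
  rw [← Matrix.mulVec_mulVec, dualIdempotent_mulVec_apply, if_pos dist_self, Matrix.mulVec,
    dotProduct, Pi.zero_apply] at h
  rw [← h]
  refine Finset.sum_congr rfl fun w _ => ?_
  rw [distMatrix_apply]
  split_ifs with hw
  · rw [one_mul]
  · rw [zero_mul, eq_zero_of_mem_localSpace hv hw]

theorem sum_distMatrix_mulVec_eq_zero (hΓ : Γ.IsDistanceRegularWith D p)
    (hv : v ∈ localSpace Γ x η) :
    ∑ j ∈ Finset.range (D + 1), Γ.distMatrix j *ᵥ v = 0 := by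
  have hJ := sum_smul_distMatrix hΓ fun _ => 1
  simp only [one_smul] at hJ
  rw [← Matrix.sum_mulVec, hJ]
  ext w
  simp only [Matrix.mulVec, dotProduct, Matrix.of_apply, one_mul, Pi.zero_apply,
    sum_eq_zero_of_mem_localSpace hv]

theorem dualIdempotent_mulVec_distMatrix_mulVec_eq_zero (hΓ : Γ.Connected)
    (hv : v ∈ localSpace Γ x η) (hij : i + 1 < j ∨ j + 1 < i) :
    Γ.dualIdempotent x i *ᵥ (Γ.distMatrix j *ᵥ v) = 0 := by
  refine dualIdempotent_mulVec_eq_zero fun w hw => ?_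
  rw [Matrix.mulVec, dotProduct]
  refine Finset.sum_eq_zero fun u _ => ?_
  by_cases hu : Γ.dist x u = 1
  · have := dist_cases_of_dist_eq_one hΓ w hu
    rw [Γ.dist_comm (u := w) (v := x)] at this
    rw [distMatrix_apply, if_neg (by omega), zero_mul]
  · rw [eq_zero_of_mem_localSpace hv hu, mul_zero]

theorem dualIdempotent_zero_mulVec_distMatrix_mulVec (hΓ : Γ.Connected)
    (hv : v ∈ localSpace Γ x η) (j : ℕ) :
    Γ.dualIdempotent x 0 *ᵥ (Γ.distMatrix j *ᵥ v) = 0 := by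
  rcases j with _ | _ | j
  · refine dualIdempotent_mulVec_eq_zero fun w hw => ?_
    rw [distMatrix_zero hΓ, Matrix.one_mulVec, eq_zero_of_mem_localSpace hv (by omega)]
  · rw [Matrix.mulVec_mulVec]
    exact (mem_localSpace.mp hv).2.1
  · exact dualIdempotent_mulVec_distMatrix_mulVec_eq_zero hΓ hv (by omega)

theorem dualIdempotent_one_mulVec_distMatrix_mulVec_mem_span (hΓ : Γ.IsDistanceRegularWith D p)
    (hv : v ∈ localSpace Γ x η) (j : ℕ) :
    Γ.dualIdempotent x 1 *ᵥ (Γ.distMatrix j *ᵥ v) ∈ Submodule.span ℂ {v} := by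
  have hne : ∀ j, j ≠ 2 →
      Γ.dualIdempotent x 1 *ᵥ (Γ.distMatrix j *ᵥ v) ∈ Submodule.span ℂ {v} := by
    intro j hj
    rcases j with _ | _ | j
    · rw [distMatrix_zero hΓ.connected, Matrix.one_mulVec, (mem_localSpace.mp hv).1]
      exact Submodule.mem_span_singleton_self v
    · rw [zero_add, dualIdempotent_one_mulVec_adj_mulVec hv]
      exact Submodule.smul_mem _ η (Submodule.mem_span_singleton_self v)
    · rw [dualIdempotent_mulVec_distMatrix_mulVec_eq_zero hΓ.connected hv (by omega)]
      exact zero_mem _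
  rcases ne_or_eq j 2 with hj | rfl
  · exact hne j hj
  rcases lt_or_ge D 2 with hD | hD
  · rw [distMatrix_eq_zero hΓ hD, Matrix.zero_mulVec, Matrix.mulVec_zero]
    exact zero_mem _
  have h := congrArg (Γ.dualIdempotent x 1 *ᵥ ·) (sum_distMatrix_mulVec_eq_zero hΓ hv)
  simp only [Matrix.mulVec_zero, Matrix.mulVec_sum] at h
  rw [← Finset.add_sum_erase _ _ (Finset.mem_range.mpr (Nat.lt_succ_of_le hD)),
    add_eq_zero_iff_eq_neg] at h
  rw [h]
  exact neg_mem (sum_mem fun j hj => hne j (Finset.ne_of_mem_erase hj))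

/-- The diagonal matrix with `(y, y)` entry `φ (∂(x, y))`, with complex entries. -/
noncomputable def complexDualAdjMatrix (Γ : SimpleGraph X) (φ : ℕ → ℝ) (x : X) : Matrix X X ℂ :=
  Matrix.diagonal fun y => (φ (Γ.dist x y) : ℂ)

theorem complexDualAdjMatrix_mulVec (hv : v ∈ localSpace Γ x η) :
    complexDualAdjMatrix Γ φ x *ᵥ v = (φ 1 : ℂ) • v := by
  ext w
  rw [complexDualAdjMatrix, Matrix.mulVec_diagonal, Pi.smul_apply, smul_eq_mul]
  by_cases hw : Γ.dist x w = 1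
  · rw [hw]
  · rw [eq_zero_of_mem_localSpace hv hw, mul_zero, mul_zero]

theorem complexDualAdjMatrix_mulVec_adj_mulVec (hΓ : Γ.Connected) (hv : v ∈ localSpace Γ x η) :
    complexDualAdjMatrix Γ φ x *ᵥ (Γ.distMatrix 1 *ᵥ v) =
      (φ 2 : ℂ) • (Γ.distMatrix 1 *ᵥ v) + (η * (φ 1 - φ 2)) • v := by
  ext w
  have hw : (Γ.distMatrix 1 *ᵥ v) w =
      (Γ.dualIdempotent x (Γ.dist x w) *ᵥ (Γ.distMatrix 1 *ᵥ v)) w := by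
    rw [dualIdempotent_mulVec_apply, if_pos rfl]
  rw [complexDualAdjMatrix, Matrix.mulVec_diagonal, Pi.add_apply, Pi.smul_apply, Pi.smul_apply,
    smul_eq_mul, smul_eq_mul]
  obtain h | h | h | h : Γ.dist x w = 0 ∨ Γ.dist x w = 1 ∨ Γ.dist x w = 2 ∨ 2 < Γ.dist x w := by
    omega
  · rw [hw, h, dualIdempotent_zero_mulVec_distMatrix_mulVec hΓ hv, Pi.zero_apply,
      eq_zero_of_mem_localSpace hv (by omega)]
    ring
  · rw [hw, h, dualIdempotent_one_mulVec_adj_mulVec hv, Pi.smul_apply, smul_eq_mul]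
    ring
  · rw [h, eq_zero_of_mem_localSpace hv (by omega)]
    ring
  · rw [hw, dualIdempotent_mulVec_distMatrix_mulVec_eq_zero hΓ hv (by omega), Pi.zero_apply,
      eq_zero_of_mem_localSpace hv (by omega)]
    ring

theorem dualIdempotent_mul_complexDualAdjMatrix (l : ℕ) :
    Γ.dualIdempotent x l * complexDualAdjMatrix Γ φ x = (φ l : ℂ) • Γ.dualIdempotent x l := by
  rw [dualIdempotent, complexDualAdjMatrix, Matrix.diagonal_mul_diagonal, ← Matrix.diagonal_smul]
  refine congrArg Matrix.diagonal (funext fun y => ?_)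
  rw [Pi.smul_apply, smul_eq_mul]
  split_ifs with hy
  · rw [hy, mul_comm]
  · rw [zero_mul, mul_zero]

theorem HasDualFlag.exists_mem_boseMesner_commutator_eq (hφ : HasDualFlag Γ D φ θ)
    (hΓ : Γ.IsDistanceRegularWith D p) (x : X) (i j : ℕ) : ∃ H ∈ Γ.boseMesner,
      Γ.distMatrix i * complexDualAdjMatrix Γ φ x * Γ.distMatrix j -
        Γ.distMatrix j * complexDualAdjMatrix Γ φ x * Γ.distMatrix i =
      complexDualAdjMatrix Γ φ x * H - H * complexDualAdjMatrix Γ φ x := by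
  obtain ⟨h, hcomm⟩ := hφ.exists_commutator_realDistMatrix_eq hΓ i j
  refine ⟨_, of_dist_mem_boseMesner hΓ fun n => (h n : ℂ), ?_⟩
  have hdual : Complex.ofRealHom.mapMatrix (dualAdjMatrix Γ φ x) = complexDualAdjMatrix Γ φ x := by
    rw [dualAdjMatrix, RingHom.mapMatrix_apply, Matrix.diagonal_map (map_zero _)]
    rfl
  have hof : Complex.ofRealHom.mapMatrix (Matrix.of fun y z => h (Γ.dist y z)) =
      Matrix.of fun y z => (h (Γ.dist y z) : ℂ) := rfl
  have hmap := congrArg Complex.ofRealHom.mapMatrix (hcomm x)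
  simpa only [map_sub, map_mul, mapMatrix_ofReal_realDistMatrix, hdual, hof] using hmap

end LocalSpace

section Stability

variable {X : Type*} [Fintype X] [DecidableEq X] {Γ : SimpleGraph X} {D : ℕ}
  {p : ℕ → ℕ → ℕ → ℕ} {x : X} {η : ℂ} {v w : X → ℂ} {φ θ : ℕ → ℝ} {i j l : ℕ}

/-- The span of the vectors `E*_i A_j v`, which turns out to be the `T(x)`-module generated by `v`
if `v` lies in a local space. -/
noncomputable def distSpan (Γ : SimpleGraph X) (x : X) (v : X → ℂ) : Submodule ℂ (X → ℂ) :=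
  Submodule.span ℂ {w | ∃ i j, w = Γ.dualIdempotent x i *ᵥ (Γ.distMatrix j *ᵥ v)}

theorem distSpan_le {W : Submodule ℂ (X → ℂ)} :
    distSpan Γ x v ≤ W ↔ ∀ i j, Γ.dualIdempotent x i *ᵥ (Γ.distMatrix j *ᵥ v) ∈ W := by
  rw [distSpan, Submodule.span_le]
  exact ⟨fun h i j => h ⟨i, j, rfl⟩, fun h w ⟨i, j, hw⟩ => hw ▸ h i j⟩

theorem dualIdempotent_mulVec_mulVec_mem_distSpan (l : ℕ) {B : Matrix X X ℂ}
    (hB : B ∈ Γ.boseMesner) : Γ.dualIdempotent x l *ᵥ (B *ᵥ v) ∈ distSpan Γ x v := by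
  induction hB using Submodule.span_induction with
  | mem B hB =>
    obtain ⟨j, -, rfl⟩ := hB
    exact Submodule.subset_span ⟨l, j, rfl⟩
  | zero =>
    rw [Matrix.zero_mulVec, Matrix.mulVec_zero]
    exact zero_mem _
  | add B C _ _ hB hC =>
    rw [Matrix.add_mulVec, Matrix.mulVec_add]
    exact add_mem hB hC
  | smul c B _ hB =>
    rw [Matrix.smul_mulVec, Matrix.mulVec_smul]
    exact Submodule.smul_mem _ c hB

theorem dualIdempotent_mulVec_mem_distSpan (l : ℕ) (hw : w ∈ distSpan Γ x v) :
    Γ.dualIdempotent x l *ᵥ w ∈ distSpan Γ x v := by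
  suffices h : distSpan Γ x v ≤ (distSpan Γ x v).comap (Γ.dualIdempotent x l).mulVecLin from h hw
  refine distSpan_le.mpr fun i j => ?_
  rw [Submodule.mem_comap, Matrix.mulVecLin_apply, Matrix.mulVec_mulVec,
    dualIdempotent_mul_dualIdempotent]
  split_ifs
  · exact Submodule.subset_span ⟨l, j, rfl⟩
  · rw [Matrix.zero_mulVec]
    exact zero_mem _

theorem dualIdempotent_mul_distMatrix_mul_dualIdempotent_eq_zero (hΓ : Γ.Connected)
    (hil : l + 1 < i ∨ i + 1 < l) :
    Γ.dualIdempotent x l * Γ.distMatrix 1 * Γ.dualIdempotent x i = 0 := by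
  ext y z
  rw [dualIdempotent, dualIdempotent, Matrix.mul_diagonal, Matrix.diagonal_mul, distMatrix_apply,
    Matrix.zero_apply]
  by_cases hyz : Γ.dist y z = 1
  · have := dist_cases_of_dist_eq_one hΓ x hyz
    split_ifs <;> first | omega | simp only [mul_zero, zero_mul]
  · rw [if_neg hyz, mul_zero, zero_mul]

theorem sum_dualIdempotent_mulVec_triple_mem_distSpan (hΓ : Γ.IsDistanceRegularWith D p)
    (v : X → ℂ) (l j : ℕ) :
    ∑ i ∈ Finset.range (D + 1), Γ.dualIdempotent x l *ᵥ (Γ.distMatrix 1 *ᵥ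
      (Γ.dualIdempotent x i *ᵥ (Γ.distMatrix j *ᵥ v))) ∈ distSpan Γ x v := by
  rw [← Matrix.mulVec_sum, ← Matrix.mulVec_sum, ← Matrix.sum_mulVec, sum_dualIdempotent hΓ,
    Matrix.one_mulVec, Matrix.mulVec_mulVec (M := Γ.distMatrix 1)]
  exact dualIdempotent_mulVec_mulVec_mem_distSpan l (distMatrix_mul_mem_boseMesner hΓ 1 j)

theorem HasDualFlag.sum_smul_triple_mem_distSpan (hφ : HasDualFlag Γ D φ θ)
    (hΓ : Γ.IsDistanceRegularWith D p) (hv : v ∈ localSpace Γ x η) (l j : ℕ) :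
    ∑ i ∈ Finset.range (D + 1), (φ i : ℂ) • (Γ.dualIdempotent x l *ᵥ (Γ.distMatrix 1 *ᵥ
      (Γ.dualIdempotent x i *ᵥ (Γ.distMatrix j *ᵥ v)))) ∈ distSpan Γ x v := by
  obtain ⟨H, hH, hcomm⟩ := hφ.exists_mem_boseMesner_commutator_eq hΓ x 1 j
  rw [sub_eq_iff_eq_add] at hcomm
  have hsmul : ∀ i, (φ i : ℂ) • (Γ.dualIdempotent x l *ᵥ (Γ.distMatrix 1 *ᵥ
      (Γ.dualIdempotent x i *ᵥ (Γ.distMatrix j *ᵥ v)))) = Γ.dualIdempotent x l *ᵥ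
        (Γ.distMatrix 1 *ᵥ (((φ i : ℂ) • Γ.dualIdempotent x i) *ᵥ (Γ.distMatrix j *ᵥ v))) := by
    intro i
    rw [Matrix.smul_mulVec, Matrix.mulVec_smul, Matrix.mulVec_smul]
  simp only [hsmul]
  rw [← Matrix.mulVec_sum, ← Matrix.mulVec_sum, ← Matrix.sum_mulVec,
    sum_smul_dualIdempotent hΓ x fun i => (φ i : ℂ), ← complexDualAdjMatrix]
  have hexpand : Γ.distMatrix 1 *ᵥ (complexDualAdjMatrix Γ φ x *ᵥ (Γ.distMatrix j *ᵥ v)) =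
      complexDualAdjMatrix Γ φ x *ᵥ (H *ᵥ v) - (φ 1 : ℂ) • (H *ᵥ v) +
        ((φ 2 : ℂ) • ((Γ.distMatrix j * Γ.distMatrix 1) *ᵥ v) +
          (η * (φ 1 - φ 2)) • (Γ.distMatrix j *ᵥ v)) := by
    rw [Matrix.mulVec_mulVec, Matrix.mulVec_mulVec, hcomm, Matrix.add_mulVec,
      Matrix.sub_mulVec, ← Matrix.mulVec_mulVec, ← Matrix.mulVec_mulVec, ← Matrix.mulVec_mulVec,
      ← Matrix.mulVec_mulVec, ← Matrix.mulVec_mulVec, complexDualAdjMatrix_mulVec hv,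
      complexDualAdjMatrix_mulVec_adj_mulVec hΓ.connected hv, Matrix.mulVec_add,
      Matrix.mulVec_smul, Matrix.mulVec_smul, Matrix.mulVec_smul]
  have hmem : ∀ B ∈ Γ.boseMesner, Γ.dualIdempotent x l *ᵥ (B *ᵥ v) ∈ distSpan Γ x v :=
    fun B hB => dualIdempotent_mulVec_mulVec_mem_distSpan l hB
  rw [hexpand, Matrix.mulVec_add, Matrix.mulVec_sub, Matrix.mulVec_add, Matrix.mulVec_mulVec,
    dualIdempotent_mul_complexDualAdjMatrix, Matrix.smul_mulVec, Matrix.mulVec_smul,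
    Matrix.mulVec_smul, Matrix.mulVec_smul]
  exact add_mem (sub_mem (Submodule.smul_mem _ _ (hmem H hH)) (Submodule.smul_mem _ _ (hmem H hH)))
    (add_mem (Submodule.smul_mem _ _ (hmem _ (distMatrix_mul_mem_boseMesner hΓ j 1)))
      (Submodule.smul_mem _ _ (hmem _ (distMatrix_mem_boseMesner hΓ j))))

theorem HasDualFlag.triple_mem_distSpan (hφ : HasDualFlag Γ D φ θ)
    (hΓ : Γ.IsDistanceRegularWith D p) (hv : v ∈ localSpace Γ x η) (l i j : ℕ) :
    Γ.dualIdempotent x l *ᵥ (Γ.distMatrix 1 *ᵥ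
      (Γ.dualIdempotent x i *ᵥ (Γ.distMatrix j *ᵥ v))) ∈ distSpan Γ x v := by
  have hinj : Set.InjOn (fun n => (φ n : ℂ)) (Set.Iio (D + 1)) := fun m hm n hn hmn =>
    hφ.injOn (Nat.lt_succ_iff.mp hm) (Nat.lt_succ_iff.mp hn) (Complex.ofReal_injective hmn)
  rw [← Submodule.Quotient.mk_eq_zero, ← Submodule.mkQ_apply]
  refine eq_zero_of_triple_relations hinj (z := fun l i j => (distSpan Γ x v).mkQ
    (Γ.dualIdempotent x l *ᵥ (Γ.distMatrix 1 *ᵥ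
      (Γ.dualIdempotent x i *ᵥ (Γ.distMatrix j *ᵥ v))))) ?_ ?_ ?_ ?_ l i j
  · intro l i j h
    by_contra hne
    refine h ?_
    rcases lt_or_ge D i with hi | hi
    · rw [dualIdempotent_eq_zero hΓ hi, Matrix.zero_mulVec, Matrix.mulVec_zero,
        Matrix.mulVec_zero, map_zero]
    rcases lt_or_ge D j with hj | hj
    · rw [distMatrix_eq_zero hΓ hj, Matrix.zero_mulVec, Matrix.mulVec_zero, Matrix.mulVec_zero,
        Matrix.mulVec_zero, map_zero]
    by_cases hil : l + 1 < i ∨ i + 1 < l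
    · rw [Matrix.mulVec_mulVec, Matrix.mulVec_mulVec,
        dualIdempotent_mul_distMatrix_mul_dualIdempotent_eq_zero hΓ.connected hil,
        Matrix.zero_mulVec, map_zero]
    · rw [dualIdempotent_mulVec_distMatrix_mulVec_eq_zero hΓ.connected hv (by omega),
        Matrix.mulVec_zero, Matrix.mulVec_zero, map_zero]
  · intro l j
    rw [← map_sum, Submodule.mkQ_apply, Submodule.Quotient.mk_eq_zero]
    exact sum_dualIdempotent_mulVec_triple_mem_distSpan hΓ v l j
  · intro l j
    simp only [← map_smul]
    rw [← map_sum, Submodule.mkQ_apply, Submodule.Quotient.mk_eq_zero]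
    exact hφ.sum_smul_triple_mem_distSpan hΓ hv l j
  · intro l i
    rw [← map_sum, ← Matrix.mulVec_sum, ← Matrix.mulVec_sum, ← Matrix.mulVec_sum,
      sum_distMatrix_mulVec_eq_zero hΓ hv, Matrix.mulVec_zero, Matrix.mulVec_zero,
      Matrix.mulVec_zero, map_zero]

theorem HasDualFlag.isTModule_distSpan (hφ : HasDualFlag Γ D φ θ)
    (hΓ : Γ.IsDistanceRegularWith D p) (hv : v ∈ localSpace Γ x η) :
    Γ.IsTModule x (distSpan Γ x v) := by
  refine hφ.isTModule hΓ (fun w hw => ?_) fun i w hw => dualIdempotent_mulVec_mem_distSpan i hw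
  suffices h : distSpan Γ x v ≤ (distSpan Γ x v).comap (Γ.distMatrix 1).mulVecLin from h hw
  refine distSpan_le.mpr fun i j => ?_
  rw [Submodule.mem_comap, Matrix.mulVecLin_apply, ← Matrix.one_mulVec (_ *ᵥ _ *ᵥ _),
    ← sum_dualIdempotent hΓ x, Matrix.sum_mulVec]
  exact sum_mem fun l _ => hφ.triple_mem_distSpan hΓ hv l i j

theorem HasDualFlag.mulVec_mem_distSpan (hφ : HasDualFlag Γ D φ θ)
    (hΓ : Γ.IsDistanceRegularWith D p) (hv : v ∈ localSpace Γ x η) {B : Matrix X X ℂ}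
    (hB : B ∈ Γ.terwilligerAlgebra x) : B *ᵥ v ∈ distSpan Γ x v := by
  refine hφ.isTModule_distSpan hΓ hv B hB v (Submodule.subset_span ⟨1, 0, ?_⟩)
  rw [distMatrix_zero hΓ.connected, Matrix.one_mulVec, (mem_localSpace.mp hv).1]

theorem HasDualFlag.dualIdempotent_zero_mulVec_mulVec_eq_zero (hφ : HasDualFlag Γ D φ θ)
    (hΓ : Γ.IsDistanceRegularWith D p) (hv : v ∈ localSpace Γ x η) {B : Matrix X X ℂ}
    (hB : B ∈ Γ.terwilligerAlgebra x) : Γ.dualIdempotent x 0 *ᵥ (B *ᵥ v) = 0 := by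
  suffices h : distSpan Γ x v ≤ LinearMap.ker (Γ.dualIdempotent x 0).mulVecLin from
    h (hφ.mulVec_mem_distSpan hΓ hv hB)
  refine distSpan_le.mpr fun i j => ?_
  rw [LinearMap.mem_ker, Matrix.mulVecLin_apply, Matrix.mulVec_mulVec,
    dualIdempotent_mul_dualIdempotent]
  split_ifs
  · exact dualIdempotent_zero_mulVec_distMatrix_mulVec hΓ.connected hv j
  · rw [Matrix.zero_mulVec]

theorem HasDualFlag.dualIdempotent_one_mulVec_mulVec_mem_span (hφ : HasDualFlag Γ D φ θ)
    (hΓ : Γ.IsDistanceRegularWith D p) (hv : v ∈ localSpace Γ x η) {B : Matrix X X ℂ}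
    (hB : B ∈ Γ.terwilligerAlgebra x) :
    Γ.dualIdempotent x 1 *ᵥ (B *ᵥ v) ∈ Submodule.span ℂ {v} := by
  suffices h : distSpan Γ x v ≤ (Submodule.span ℂ {v}).comap (Γ.dualIdempotent x 1).mulVecLin from
    h (hφ.mulVec_mem_distSpan hΓ hv hB)
  refine distSpan_le.mpr fun i j => ?_
  rw [Submodule.mem_comap, Matrix.mulVecLin_apply, Matrix.mulVec_mulVec,
    dualIdempotent_mul_dualIdempotent]
  split_ifs
  · exact dualIdempotent_one_mulVec_distMatrix_mulVec_mem_span hΓ hv j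
  · rw [Matrix.zero_mulVec]
    exact zero_mem _

/-- The algebra `E*_1 T E*_1` acts on a local space by scalars. -/
theorem HasDualFlag.exists_dualIdempotent_one_mulVec_eq_smul (hφ : HasDualFlag Γ D φ θ)
    (hΓ : Γ.IsDistanceRegularWith D p) {B : Matrix X X ℂ} (hB : B ∈ Γ.terwilligerAlgebra x)
    (η : ℂ) : ∃ c : ℂ, ∀ v ∈ localSpace Γ x η, Γ.dualIdempotent x 1 *ᵥ (B *ᵥ v) = c • v := by
  have hspan : ∀ v ∈ localSpace Γ x η, Γ.dualIdempotent x 1 *ᵥ (B *ᵥ v) ∈ Submodule.span ℂ {v} :=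
    fun v hv => hφ.dualIdempotent_one_mulVec_mulVec_mem_span hΓ hv hB
  let f : localSpace Γ x η →ₗ[ℂ] localSpace Γ x η :=
    ((Γ.dualIdempotent x 1).mulVecLin ∘ₗ B.mulVecLin).restrict fun v hv =>
      (Submodule.span_singleton_le_iff_mem _ _).mpr hv (hspan v hv)
  obtain ⟨c, hc⟩ := f.exists_eq_smul_id_of_forall_notLinearIndependent fun v hli => by
    obtain ⟨c, hc⟩ := Submodule.mem_span_singleton.mp (hspan v v.2)
    have hrel : c • v + (-1 : ℂ) • f v = 0 := Subtype.ext <| by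
      change c • (v : X → ℂ) + (-1 : ℂ) • (Γ.dualIdempotent x 1 *ᵥ (B *ᵥ v)) = 0
      rw [hc, neg_one_smul, add_neg_cancel]
    exact neg_ne_zero.mpr one_ne_zero (LinearIndependent.pair_iff.mp hli c (-1) hrel).2
  exact ⟨c, fun v hv => congrArg Subtype.val (LinearMap.congr_fun hc ⟨v, hv⟩)⟩

end Stability

section Modules

variable {X : Type*} {Γ : SimpleGraph X} {D : ℕ} {p : ℕ → ℕ → ℕ → ℕ} {x : X} {η : ℂ}
  {φ θ : ℕ → ℝ}

theorem distMatrix_conjTranspose (i : ℕ) : (Γ.distMatrix i)ᴴ = Γ.distMatrix i := by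
  ext y z
  rw [Matrix.conjTranspose_apply, distMatrix_apply, distMatrix_apply, Γ.dist_comm, apply_ite star,
    star_one, star_zero]

theorem dualIdempotent_conjTranspose [DecidableEq X] (i : ℕ) :
    (Γ.dualIdempotent x i)ᴴ = Γ.dualIdempotent x i := by
  rw [dualIdempotent, Matrix.diagonal_conjTranspose]
  refine congrArg Matrix.diagonal (funext fun y => ?_)
  rw [Pi.star_apply, apply_ite star, star_one, star_zero]

variable [Fintype X]

theorem mulVec_dotProduct_star (B : Matrix X X ℂ) (u v : X → ℂ) :
    (B *ᵥ u) ⬝ᵥ star v = u ⬝ᵥ star (Bᴴ *ᵥ v) := by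
  rw [Matrix.star_mulVec, Matrix.conjTranspose_conjTranspose, dotProduct_comm,
    Matrix.dotProduct_mulVec, dotProduct_comm]

theorem dotProduct_star_eq_zero_iff {v : X → ℂ} : v ⬝ᵥ star v = 0 ↔ v = 0 := by
  open scoped ComplexOrder in exact dotProduct_self_star_eq_zero

variable [DecidableEq X] {u v v' w : X → ℂ} {W W' : Submodule ℂ (X → ℂ)}

theorem conjTranspose_mem_terwilligerAlgebra (hΓ : Γ.IsDistanceRegularWith D p)
    {B : Matrix X X ℂ} (hB : B ∈ Γ.terwilligerAlgebra x) : Bᴴ ∈ Γ.terwilligerAlgebra x := by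
  suffices h : Γ.terwilligerAlgebra x ≤ star (Γ.terwilligerAlgebra x) from
    Subalgebra.mem_star_iff _ _ |>.mp (h hB)
  refine terwilligerAlgebra_le (fun i => ?_) fun i => ?_
  · rw [Subalgebra.mem_star_iff, Matrix.star_eq_conjTranspose, distMatrix_conjTranspose]
    exact distMatrix_mem_terwilligerAlgebra hΓ x i
  · rw [Subalgebra.mem_star_iff, Matrix.star_eq_conjTranspose, dualIdempotent_conjTranspose]
    exact dualIdempotent_mem_terwilligerAlgebra hΓ x i

/-- The linear map `B ↦ B v` on the Terwilliger algebra. -/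
noncomputable def orbitMap (Γ : SimpleGraph X) (x : X) (v : X → ℂ) :
    Γ.terwilligerAlgebra x →ₗ[ℂ] (X → ℂ) where
  toFun B := B.1 *ᵥ v
  map_add' _ _ := Matrix.add_mulVec _ _ _
  map_smul' _ _ := Matrix.smul_mulVec _ _ _

/-- The `T(x)`-module `T v` generated by `v`. -/
noncomputable def cyclicModule (Γ : SimpleGraph X) (x : X) (v : X → ℂ) : Submodule ℂ (X → ℂ) :=
  LinearMap.range (orbitMap Γ x v)

theorem mem_cyclicModule :
    w ∈ cyclicModule Γ x v ↔ ∃ B ∈ Γ.terwilligerAlgebra x, B *ᵥ v = w :=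
  ⟨fun ⟨B, hB⟩ => ⟨B.1, B.2, hB⟩, fun ⟨B, hB, h⟩ => ⟨⟨B, hB⟩, h⟩⟩

theorem self_mem_cyclicModule (v : X → ℂ) : v ∈ cyclicModule Γ x v :=
  mem_cyclicModule.mpr ⟨1, one_mem _, Matrix.one_mulVec v⟩

theorem isTModule_cyclicModule (v : X → ℂ) : Γ.IsTModule x (cyclicModule Γ x v) := by
  intro B hB w hw
  obtain ⟨C, hC, rfl⟩ := mem_cyclicModule.mp hw
  exact mem_cyclicModule.mpr ⟨B * C, mul_mem hB hC, (Matrix.mulVec_mulVec v B C).symm⟩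

theorem cyclicModule_le (hW : Γ.IsTModule x W) (hv : v ∈ W) : cyclicModule Γ x v ≤ W := by
  intro w hw
  obtain ⟨C, hC, rfl⟩ := mem_cyclicModule.mp hw
  exact hW C hC v hv

theorem cyclicModule_ne_bot (hv0 : v ≠ 0) : cyclicModule Γ x v ≠ ⊥ := fun h =>
  hv0 ((Submodule.mem_bot ℂ).mp (h ▸ self_mem_cyclicModule v))

theorem eq_cyclicModule_of_isIrreducible (hW : Γ.IsIrreducibleTModule x W) (hv : v ∈ W)
    (hv0 : v ≠ 0) : W = cyclicModule Γ x v :=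
  ((hW.2.2 _ (cyclicModule_le hW.1 hv) (isTModule_cyclicModule v)).resolve_left
    (cyclicModule_ne_bot hv0)).symm

theorem eq_zero_of_mem_cyclicModule_of_dualIdempotent_one (hΓ : Γ.IsDistanceRegularWith D p)
    (hv : Γ.dualIdempotent x 1 *ᵥ v = v) (hu : u ∈ cyclicModule Γ x v)
    (hE : ∀ w ∈ cyclicModule Γ x u, Γ.dualIdempotent x 1 *ᵥ w = 0) : u = 0 := by
  obtain ⟨B, hB, hBv⟩ := mem_cyclicModule.mp hu
  have hw := hE _ (mem_cyclicModule.mpr ⟨_, conjTranspose_mem_terwilligerAlgebra hΓ hB, rfl⟩)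
  rw [← dotProduct_star_eq_zero_iff]
  nth_rewrite 1 [← hBv]
  rw [← hv, mulVec_dotProduct_star, mulVec_dotProduct_star, dualIdempotent_conjTranspose, hw,
    star_zero, dotProduct_zero]

theorem HasDualFlag.isIrreducible_cyclicModule (hφ : HasDualFlag Γ D φ θ)
    (hΓ : Γ.IsDistanceRegularWith D p) (hv : v ∈ localSpace Γ x η) (hv0 : v ≠ 0) :
    Γ.IsIrreducibleTModule x (cyclicModule Γ x v) := by
  refine ⟨isTModule_cyclicModule v, cyclicModule_ne_bot hv0, fun U hU hUT => ?_⟩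
  by_cases hE : ∀ u ∈ U, Γ.dualIdempotent x 1 *ᵥ u = 0
  · refine Or.inl ((Submodule.eq_bot_iff U).mpr fun u hu => ?_)
    exact eq_zero_of_mem_cyclicModule_of_dualIdempotent_one hΓ (mem_localSpace.mp hv).1 (hU hu)
      fun w hw => hE w (cyclicModule_le hUT hu hw)
  · refine Or.inr (le_antisymm hU (cyclicModule_le hUT ?_))
    push Not at hE
    obtain ⟨u, hu, hu0⟩ := hE
    obtain ⟨B, hB, rfl⟩ := mem_cyclicModule.mp (hU hu)
    obtain ⟨c, hc⟩ := hφ.exists_dualIdempotent_one_mulVec_eq_smul hΓ hB η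
    have hcv := hUT _ (dualIdempotent_mem_terwilligerAlgebra hΓ x 1) _ hu
    rw [hc v hv] at hu0 hcv
    exact (Submodule.smul_mem_iff _ (smul_ne_zero_iff.mp hu0).1).mp hcv

theorem HasDualFlag.dualComponent_one_cyclicModule (hφ : HasDualFlag Γ D φ θ)
    (hΓ : Γ.IsDistanceRegularWith D p) (hv : v ∈ localSpace Γ x η) :
    Γ.dualComponent x 1 (cyclicModule Γ x v) = Submodule.span ℂ {v} := by
  refine le_antisymm ?_ ?_
  · rintro _ ⟨u, hu, rfl⟩
    obtain ⟨B, hB, rfl⟩ := mem_cyclicModule.mp hu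
    exact hφ.dualIdempotent_one_mulVec_mulVec_mem_span hΓ hv hB
  · rw [Submodule.span_singleton_le_iff_mem]
    exact ⟨v, self_mem_cyclicModule v, (mem_localSpace.mp hv).1⟩

theorem HasDualFlag.dualComponent_zero_cyclicModule (hφ : HasDualFlag Γ D φ θ)
    (hΓ : Γ.IsDistanceRegularWith D p) (hv : v ∈ localSpace Γ x η) :
    Γ.dualComponent x 0 (cyclicModule Γ x v) = ⊥ := by
  rw [eq_bot_iff]
  rintro _ ⟨u, hu, rfl⟩
  obtain ⟨B, hB, rfl⟩ := mem_cyclicModule.mp hu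
  exact hφ.dualIdempotent_zero_mulVec_mulVec_eq_zero hΓ hv hB

theorem HasDualFlag.hasEndpoint_cyclicModule (hφ : HasDualFlag Γ D φ θ)
    (hΓ : Γ.IsDistanceRegularWith D p) (hD : 1 ≤ D) (hv : v ∈ localSpace Γ x η) (hv0 : v ≠ 0) :
    Γ.HasEndpoint x (cyclicModule Γ x v) 1 := by
  refine ⟨⟨hΓ.diam_eq ▸ hD, ?_⟩, fun i hi => Nat.one_le_iff_ne_zero.mpr ?_⟩
  · rwa [hφ.dualComponent_one_cyclicModule hΓ hv, Ne, Submodule.span_singleton_eq_bot]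
  · rintro rfl
    exact hi.2 (hφ.dualComponent_zero_cyclicModule hΓ hv)

theorem HasDualFlag.hasLocalEigenvalue_cyclicModule (hφ : HasDualFlag Γ D φ θ)
    (hΓ : Γ.IsDistanceRegularWith D p) (hv : v ∈ localSpace Γ x η) (hv0 : v ≠ 0) :
    Γ.HasLocalEigenvalue x (cyclicModule Γ x v) η := by
  rw [HasLocalEigenvalue, hφ.dualComponent_one_cyclicModule hΓ hv]
  refine ⟨finrank_span_singleton hv0, fun w hw => ?_⟩
  obtain ⟨c, rfl⟩ := Submodule.mem_span_singleton.mp hw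
  exact (mem_localSpace.mp (Submodule.smul_mem _ c hv)).2.2

/-- `‖B v‖² = ⟨v, E*_1 Bᴴ B v⟩`, and `E*_1 Bᴴ B` acts on the local space as a scalar. -/
theorem HasDualFlag.mulVec_eq_zero_iff (hφ : HasDualFlag Γ D φ θ)
    (hΓ : Γ.IsDistanceRegularWith D p) (hv : v ∈ localSpace Γ x η) (hv0 : v ≠ 0)
    (hv' : v' ∈ localSpace Γ x η) (hv0' : v' ≠ 0) {B : Matrix X X ℂ}
    (hB : B ∈ Γ.terwilligerAlgebra x) : B *ᵥ v = 0 ↔ B *ᵥ v' = 0 := by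
  obtain ⟨c, hc⟩ := hφ.exists_dualIdempotent_one_mulVec_eq_smul hΓ
    (mul_mem (conjTranspose_mem_terwilligerAlgebra hΓ hB) hB) η
  have hiff : ∀ v ∈ localSpace Γ x η, v ≠ 0 → (B *ᵥ v = 0 ↔ c = 0) := by
    intro v hv hv0
    have hnorm : (B *ᵥ v) ⬝ᵥ star (B *ᵥ v) = c * (v ⬝ᵥ star v) := by
      rw [← smul_eq_mul, ← smul_dotProduct, ← hc v hv,
        mulVec_dotProduct_star (Γ.dualIdempotent x 1), dualIdempotent_conjTranspose,
        (mem_localSpace.mp hv).1, ← Matrix.mulVec_mulVec, mulVec_dotProduct_star Bᴴ,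
        Matrix.conjTranspose_conjTranspose]
    rw [← dotProduct_star_eq_zero_iff, hnorm, mul_eq_zero,
      or_iff_left (mt dotProduct_star_eq_zero_iff.mp hv0)]
  exact (hiff v hv hv0).trans (hiff v' hv' hv0').symm

theorem tModuleIso_cyclicModule_of_ker_eq
    (hker : LinearMap.ker (orbitMap Γ x v) = LinearMap.ker (orbitMap Γ x v')) :
    Γ.TModuleIso x (cyclicModule Γ x v) (cyclicModule Γ x v') := by
  let σ : cyclicModule Γ x v ≃ₗ[ℂ] cyclicModule Γ x v' :=
    (orbitMap Γ x v).quotKerEquivRange.symm ≪≫ₗ Submodule.quotEquivOfEq _ _ hker ≪≫ₗ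
      (orbitMap Γ x v').quotKerEquivRange
  have hσ : ∀ B ∈ Γ.terwilligerAlgebra x, ∀ w : cyclicModule Γ x v,
      (w : X → ℂ) = B *ᵥ v → (σ w : X → ℂ) = B *ᵥ v' := by
    intro B hB w hw
    obtain rfl : w = (orbitMap Γ x v).quotKerEquivRange (Submodule.Quotient.mk ⟨B, hB⟩) :=
      Subtype.ext hw
    refine (congrArg (fun q => ((orbitMap Γ x v').quotKerEquivRange
      (Submodule.quotEquivOfEq _ _ hker q) : X → ℂ)) (LinearEquiv.symm_apply_apply _ _)).trans ?_
    rfl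
  refine ⟨σ, fun B hB w u hu => ?_⟩
  obtain ⟨C, hC, hCw⟩ := mem_cyclicModule.mp w.2
  rw [hσ C hC w hCw.symm, Matrix.mulVec_mulVec]
  refine hσ _ (mul_mem hB hC) u ?_
  rw [hu, ← hCw, Matrix.mulVec_mulVec]

theorem HasDualFlag.tModuleIso_cyclicModule (hφ : HasDualFlag Γ D φ θ)
    (hΓ : Γ.IsDistanceRegularWith D p) (hv : v ∈ localSpace Γ x η) (hv0 : v ≠ 0)
    (hv' : v' ∈ localSpace Γ x η) (hv0' : v' ≠ 0) :
    Γ.TModuleIso x (cyclicModule Γ x v) (cyclicModule Γ x v') :=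
  tModuleIso_cyclicModule_of_ker_eq
    (Submodule.ext fun B => hφ.mulVec_eq_zero_iff hΓ hv hv0 hv' hv0' B.2)

theorem exists_mem_localSpace_of_tModuleIso (hΓ : Γ.IsDistanceRegularWith D p)
    (h : Γ.TModuleIso x W W') (hvW : v ∈ W) (hv : v ∈ localSpace Γ x η) (hv0 : v ≠ 0) :
    ∃ v' ∈ W', v' ∈ localSpace Γ x η ∧ v' ≠ 0 := by
  obtain ⟨σ, hσ⟩ := h
  obtain ⟨hv1, hv2, hv3⟩ := mem_localSpace.mp hv
  have hE0 := dualIdempotent_mem_terwilligerAlgebra hΓ x 0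
  have hE1 := dualIdempotent_mem_terwilligerAlgebra hΓ x 1
  have hA := distMatrix_mem_terwilligerAlgebra hΓ x 1
  refine ⟨σ ⟨v, hvW⟩, (σ _).2, mem_localSpace.mpr ⟨?_, ?_, ?_⟩, ?_⟩
  · exact (hσ _ hE1 ⟨v, hvW⟩ ⟨v, hvW⟩ hv1.symm).symm
  · have h0 := hσ _ (mul_mem hE0 hA) ⟨v, hvW⟩ 0 hv2.symm
    rw [map_zero] at h0
    exact h0.symm
  · have hη := hσ _ (mul_mem (mul_mem hE1 hA) hE1) ⟨v, hvW⟩ (η • ⟨v, hvW⟩) hv3.symm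
    rw [map_smul] at hη
    exact hη.symm
  · intro h0
    have hv' : σ ⟨v, hvW⟩ = 0 := Subtype.ext h0
    exact hv0 (congrArg Subtype.val ((LinearEquiv.map_eq_zero_iff σ).mp hv'))

theorem tModuleIso_symm (hW : Γ.IsTModule x W) (h : Γ.TModuleIso x W W') :
    Γ.TModuleIso x W' W := by
  obtain ⟨σ, hσ⟩ := h
  refine ⟨σ.symm, fun B hB w u hu => ?_⟩
  have h1 := hσ B hB (σ.symm w) ⟨B *ᵥ (σ.symm w : X → ℂ), hW B hB _ (σ.symm w).2⟩ rfl
  rw [LinearEquiv.apply_symm_apply, ← hu] at h1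
  rw [← Subtype.ext h1, LinearEquiv.symm_apply_apply]

end Modules

section Decomposition

variable {X : Type*} [Fintype X] {u v : X → ℂ} {U W M : Submodule ℂ (X → ℂ)}

theorem dotProduct_star_eq_zero_comm : u ⬝ᵥ star v = 0 ↔ v ⬝ᵥ star u = 0 := by
  rw [Matrix.dotProduct_star, star_eq_zero]

theorem eq_zero_of_sum_eq_zero_of_orthogonal {ι : Type*} {s : Finset ι} {f : ι → X → ℂ}
    (hf : ∀ i ∈ s, ∀ j ∈ s, i ≠ j → f i ⬝ᵥ star (f j) = 0) (h : ∑ i ∈ s, f i = 0) {j : ι}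
    (hj : j ∈ s) : f j = 0 := by
  have hsum := congrArg (· ⬝ᵥ star (f j)) h
  rw [sum_dotProduct, zero_dotProduct,
    Finset.sum_eq_single_of_mem j hj fun i hi hij => hf i hi j hj hij] at hsum
  exact dotProduct_star_eq_zero_iff.mp hsum

/-- The orthogonal complement for the Hermitian form `⟨u, v⟩ = uᵗ v̄`. -/
def hermitianCompl (U : Submodule ℂ (X → ℂ)) : Submodule ℂ (X → ℂ) where
  carrier := {v | ∀ u ∈ U, v ⬝ᵥ star u = 0}
  add_mem' := fun hv hw u hu => by rw [add_dotProduct, hv u hu, hw u hu, add_zero]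
  zero_mem' := fun u _ => zero_dotProduct _
  smul_mem' := fun c v hv u hu => by rw [smul_dotProduct, hv u hu, smul_zero]

theorem isCompl_hermitianCompl (U : Submodule ℂ (X → ℂ)) : IsCompl U (hermitianCompl U) := by
  refine IsCompl.of_eq ?_ ?_
  · exact (Submodule.eq_bot_iff _).mpr fun u hu =>
      dotProduct_star_eq_zero_iff.mp (hu.2 u hu.1)
  · refine eq_top_iff.mpr fun v _ => ?_
    let e := WithLp.linearEquiv 2 ℂ (X → ℂ)
    obtain ⟨y, hy, z, hz, h⟩ :=
      (U.comap e.toLinearMap).exists_add_mem_mem_orthogonal (e.symm v)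
    rw [← e.apply_symm_apply v, h, map_add]
    refine Submodule.add_mem_sup hy fun u hu => ?_
    exact ((U.comap e.toLinearMap).mem_orthogonal z).mp hz (e.symm u) hu

variable [DecidableEq X] {Γ : SimpleGraph X} {D : ℕ} {p : ℕ → ℕ → ℕ → ℕ} {x : X} {η : ℂ}
  {φ θ : ℕ → ℝ} {S : Finset (Submodule ℂ (X → ℂ))}

theorem isTModule_hermitianCompl (hΓ : Γ.IsDistanceRegularWith D p) (hU : Γ.IsTModule x U) :
    Γ.IsTModule x (hermitianCompl U) := by
  intro B hB v hv u hu
  rw [mulVec_dotProduct_star]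
  exact hv _ (hU _ (conjTranspose_mem_terwilligerAlgebra hΓ hB) u hu)

theorem exists_isIrreducibleTModule_le (hW : Γ.IsTModule x W) (hW0 : W ≠ ⊥) :
    ∃ U ≤ W, Γ.IsIrreducibleTModule x U := by
  induction W using WellFoundedLT.induction with
  | ind W ih =>
    by_cases hirr : Γ.IsIrreducibleTModule x W
    · exact ⟨W, le_rfl, hirr⟩
    · rw [IsIrreducibleTModule] at hirr
      push Not at hirr
      obtain ⟨U, hUW, hU, hU0, hne⟩ := hirr hW hW0
      obtain ⟨U', hU', hirr'⟩ := ih U (lt_of_le_of_ne hUW hne) hU hU0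
      exact ⟨U', hU'.trans hUW, hirr'⟩

theorem exists_orthogonal_sSup_eq (hΓ : Γ.IsDistanceRegularWith D p) (hW : Γ.IsTModule x W) :
    ∃ S : Finset (Submodule ℂ (X → ℂ)), (∀ U ∈ S, Γ.IsIrreducibleTModule x U) ∧
      (∀ U ∈ S, ∀ U' ∈ S, U ≠ U' → ∀ u ∈ U, ∀ v ∈ U', u ⬝ᵥ star v = 0) ∧
      sSup (S : Set (Submodule ℂ (X → ℂ))) = W := by
  classical
  induction W using WellFoundedLT.induction with
  | ind W ih =>
    rcases eq_or_ne W ⊥ with rfl | hW0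
    · exact ⟨∅, by simp, by simp, by simp⟩
    obtain ⟨U, hUW, hU⟩ := exists_isIrreducibleTModule_le hW hW0
    have hT : Γ.IsTModule x (hermitianCompl U ⊓ W) := fun B hB v hv =>
      ⟨isTModule_hermitianCompl hΓ hU.1 B hB v hv.1, hW B hB v hv.2⟩
    have hlt : hermitianCompl U ⊓ W < W := by
      refine lt_of_le_of_ne inf_le_right fun h => hU.2.1 ?_
      exact (isCompl_hermitianCompl U).disjoint.eq_bot_of_le (hUW.trans (inf_eq_right.mp h))
    obtain ⟨S, hS, horth, hsup⟩ := ih _ hlt hT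
    have hle : ∀ U' ∈ S, U' ≤ hermitianCompl U := fun U' hU' =>
      (le_sSup (Finset.mem_coe.mpr hU')).trans (hsup.trans_le inf_le_left)
    refine ⟨insert U S, Finset.forall_mem_insert .. |>.mpr ⟨hU, hS⟩, ?_, ?_⟩
    · intro U₁ h₁ U₂ h₂ hne u hu v hv
      rcases Finset.mem_insert.mp h₁ with rfl | h₁' <;>
        rcases Finset.mem_insert.mp h₂ with rfl | h₂'
      · exact absurd rfl hne
      · exact dotProduct_star_eq_zero_comm.mp (hle _ h₂' hv u hu)
      · exact hle _ h₁' hu v hv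
      · exact horth _ h₁' _ h₂' hne u hu v hv
    · rw [Finset.coe_insert, sSup_insert, hsup, ← sup_inf_assoc_of_le _ hUW,
        (isCompl_hermitianCompl U).sup_eq_top, top_inf_eq]

theorem exists_isOrthogonalDecomposition (hΓ : Γ.IsDistanceRegularWith D p) (x : X) :
    ∃ S, Γ.IsOrthogonalDecomposition x S := by
  obtain ⟨S, hS, horth, hsup⟩ := exists_orthogonal_sSup_eq (x := x) (W := ⊤) hΓ
    fun _ _ _ _ => Submodule.mem_top
  exact ⟨S, hS, horth, hsup⟩

theorem exists_sum_eq_of_mem_localSpace (hΓ : Γ.IsDistanceRegularWith D p)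
    (hS : Γ.IsOrthogonalDecomposition x S) (hv : v ∈ localSpace Γ x η) :
    ∃ f : Submodule ℂ (X → ℂ) → X → ℂ, (∀ U ∈ S, f U ∈ U ⊓ localSpace Γ x η) ∧
      ∑ U ∈ S, f U = v := by
  have hv' : v ∈ ⨆ U ∈ S, U := by
    have hsup := hS.sSup_eq
    rw [sSup_eq_iSup] at hsup
    exact hsup.symm ▸ Submodule.mem_top
  obtain ⟨f, hf⟩ := (Submodule.mem_iSup_finset_iff_exists_sum (fun U => U) v).mp hv'
  have hker : ∀ B ∈ Γ.terwilligerAlgebra x, B *ᵥ v = 0 → ∀ U ∈ S, B *ᵥ (f U : X → ℂ) = 0 := by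
    intro B hB hBv U hU
    have hmem : ∀ U ∈ S, B *ᵥ (f U : X → ℂ) ∈ U := fun U hU =>
      (hS.irreducible U hU).1 B hB _ (f U).2
    refine eq_zero_of_sum_eq_zero_of_orthogonal (f := fun U => B *ᵥ (f U : X → ℂ))
      (fun U hU U' hU' hne => hS.orthogonal U hU U' hU' hne _ (hmem U hU) _ (hmem U' hU')) ?_ hU
    rw [← Matrix.mulVec_sum, hf, hBv]
  have hE0 := dualIdempotent_mem_terwilligerAlgebra hΓ x 0
  have hE1 := dualIdempotent_mem_terwilligerAlgebra hΓ x 1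
  have hA := distMatrix_mem_terwilligerAlgebra hΓ x 1
  refine ⟨fun U => f U, fun U hU => ⟨(f U).2, ⟨?_, ?_⟩, ?_⟩, hf⟩
  · exact hker _ (sub_mem hE1 (one_mem _)) hv.1.1 U hU
  · exact hker _ (mul_mem hE0 hA) hv.1.2 U hU
  · exact hker _ (sub_mem (mul_mem (mul_mem hE1 hA) hE1) (Subalgebra.smul_mem _ (one_mem _) _))
      hv.2 U hU

theorem localSpace_le_of_inf_le (hΓ : Γ.IsDistanceRegularWith D p)
    (hS : Γ.IsOrthogonalDecomposition x S) (hM : ∀ U ∈ S, U ⊓ localSpace Γ x η ≤ M) :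
    localSpace Γ x η ≤ M := by
  intro v hv
  obtain ⟨f, hf, rfl⟩ := exists_sum_eq_of_mem_localSpace hΓ hS hv
  exact Submodule.sum_mem _ fun U hU => hM U hU (hf U hU)

theorem HasDualFlag.inf_localSpace_eq_span (hφ : HasDualFlag Γ D φ θ)
    (hΓ : Γ.IsDistanceRegularWith D p) (hU : Γ.IsIrreducibleTModule x U)
    (hv : v ∈ U ⊓ localSpace Γ x η) (hv0 : v ≠ 0) :
    U ⊓ localSpace Γ x η = Submodule.span ℂ {v} := by
  refine le_antisymm (fun u hu => ?_) ((Submodule.span_singleton_le_iff_mem _ _).mpr hv)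
  rw [← hφ.dualComponent_one_cyclicModule hΓ hv.2, ← eq_cyclicModule_of_isIrreducible hU hv.1 hv0]
  exact ⟨u, hu.1, (mem_localSpace.mp hu.2).1⟩

theorem HasDualFlag.tModuleIso_cyclicModule_iff (hφ : HasDualFlag Γ D φ θ)
    (hΓ : Γ.IsDistanceRegularWith D p) (hU : Γ.IsIrreducibleTModule x U)
    (hv : v ∈ localSpace Γ x η) (hv0 : v ≠ 0) :
    Γ.TModuleIso x U (cyclicModule Γ x v) ↔ U ⊓ localSpace Γ x η ≠ ⊥ := by
  rw [Submodule.ne_bot_iff]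
  constructor
  · intro h
    obtain ⟨w, hwU, hw, hw0⟩ := exists_mem_localSpace_of_tModuleIso hΓ (tModuleIso_symm hU.1 h)
      (self_mem_cyclicModule v) hv hv0
    exact ⟨w, ⟨hwU, hw⟩, hw0⟩
  · rintro ⟨w, ⟨hwU, hw⟩, hw0⟩
    rw [eq_cyclicModule_of_isIrreducible hU hwU hw0]
    exact hφ.tModuleIso_cyclicModule hΓ hw hw0 hv hv0

theorem HasDualFlag.finrank_localSpace (hφ : HasDualFlag Γ D φ θ)
    (hΓ : Γ.IsDistanceRegularWith D p) (hS : Γ.IsOrthogonalDecomposition x S) :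
    Module.finrank ℂ (localSpace Γ x η) = {U | U ∈ S ∧ U ⊓ localSpace Γ x η ≠ ⊥}.ncard := by
  classical
  set F := S.filter fun U => U ⊓ localSpace Γ x η ≠ ⊥ with hF
  have hex : ∀ U ∈ F, ∃ v ∈ U ⊓ localSpace Γ x η, v ≠ 0 := fun U hU =>
    Submodule.exists_mem_ne_zero_of_ne_bot (Finset.mem_filter.mp hU).2
  have hFS : ∀ U ∈ F, U ∈ S := fun U hU => (Finset.mem_filter.mp hU).1
  choose! g hg hg0 using hex
  have hli : LinearIndependent ℂ fun U : F => g U := by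
    rw [linearIndependent_iff']
    intro s c hc i hi
    refine (smul_eq_zero.mp (eq_zero_of_sum_eq_zero_of_orthogonal
      (fun i _ j _ hij => ?_) hc hi)).resolve_right (hg0 i i.2)
    exact hS.orthogonal i (hFS i i.2) j (hFS j j.2) (Subtype.coe_injective.ne hij) _
      (Submodule.smul_mem _ _ (hg i i.2).1) _ (Submodule.smul_mem _ _ (hg j j.2).1)
  have hspan : Submodule.span ℂ (Set.range fun U : F => g U) = localSpace Γ x η := by
    refine le_antisymm (Submodule.span_le.mpr ?_) (localSpace_le_of_inf_le hΓ hS fun U hU => ?_)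
    · rintro _ ⟨U, rfl⟩
      exact (hg U U.2).2
    · rcases eq_or_ne (U ⊓ localSpace Γ x η) ⊥ with hbot | hbot
      · exact hbot.trans_le bot_le
      · have hUF : U ∈ F := Finset.mem_filter.mpr ⟨hU, hbot⟩
        rw [hφ.inf_localSpace_eq_span hΓ (hS.irreducible U hU) (hg U hUF) (hg0 U hUF),
          Submodule.span_singleton_le_iff_mem]
        exact Submodule.subset_span ⟨⟨U, hUF⟩, rfl⟩
  have hcard : {U | U ∈ S ∧ U ⊓ localSpace Γ x η ≠ ⊥}.ncard = F.card := by
    rw [hF, ← Set.ncard_coe_finset, Finset.coe_filter]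
  rw [hcard, ← Fintype.card_coe F, ← finrank_span_eq_card hli, hspan]

theorem HasDualFlag.appearsWithMultiplicity_cyclicModule (hφ : HasDualFlag Γ D φ θ)
    (hΓ : Γ.IsDistanceRegularWith D p) (hv : v ∈ localSpace Γ x η) (hv0 : v ≠ 0) :
    Γ.AppearsWithMultiplicity x (cyclicModule Γ x v) (Module.finrank ℂ (localSpace Γ x η)) := by
  refine ⟨exists_isOrthogonalDecomposition hΓ x, fun S hS => ?_⟩
  rw [hφ.finrank_localSpace hΓ hS]
  congr 1
  ext U
  exact and_congr_right fun hU => hφ.tModuleIso_cyclicModule_iff hΓ (hS.irreducible U hU) hv hv0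

end Decomposition

section LocalGraph

variable {X : Type*} {Γ : SimpleGraph X} {D : ℕ} {p : ℕ → ℕ → ℕ → ℕ}
  {b α β : ℝ} {x : X} {η c : ℂ} {v : X → ℂ} {n : ℕ}

/-- The matrix of the relation `∂(y, z) ≤ n` between neighbours `y`, `z` of `x`. The cases
`n = 0, 1, 2` are `E*_1`, `E*_1 (I + A) E*_1` and `E*_1 J E*_1`, with `J` the all-ones matrix. -/
noncomputable def localMatrix (Γ : SimpleGraph X) (x : X) (n : ℕ) : Matrix X X ℂ :=
  Matrix.of fun y z => if Γ.dist x y = 1 ∧ Γ.dist x z = 1 ∧ Γ.dist y z ≤ n then 1 else 0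

theorem localMatrix_apply (y z : X) : localMatrix Γ x n y z =
    if Γ.dist x y = 1 ∧ Γ.dist x z = 1 ∧ Γ.dist y z ≤ n then 1 else 0 := rfl

theorem localMatrix_zero [DecidableEq X] (hΓ : Γ.Connected) :
    localMatrix Γ x 0 = Γ.dualIdempotent x 1 := by
  ext y z
  have := hΓ.dist_eq_zero_iff (u := y) (v := z)
  rw [localMatrix_apply, dualIdempotent, Matrix.diagonal_apply]
  split_ifs <;> grind

theorem localMatrix_symm (y z : X) : localMatrix Γ x n y z = localMatrix Γ x n z y := by
  simp only [localMatrix_apply, Γ.dist_comm (u := y) (v := z), and_left_comm]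

variable [Fintype X]

theorem sum_localMatrix {y : X} (hy : Γ.dist x y = 1) : ∑ u, localMatrix Γ x n y u =
    (Finset.univ.filter fun u => Γ.dist x u = 1 ∧ Γ.dist y u ≤ n).card := by
  simp only [localMatrix_apply, hy, true_and, Finset.sum_boole]

theorem sum_localMatrix_zero (hΓ : Γ.Connected) {y : X} (hy : Γ.dist x y = 1) :
    ∑ u, localMatrix Γ x 0 y u = 1 := by
  rw [sum_localMatrix hy, Nat.cast_eq_one, Finset.card_eq_one]
  refine ⟨y, Finset.ext fun u => ?_⟩
  have := hΓ.dist_eq_zero_iff (u := y) (v := u)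
  simp only [Finset.mem_filter_univ, Finset.mem_singleton]
  grind

theorem sum_localMatrix_one (hΓ : Γ.IsDistanceRegularWith D p) (hD : 1 ≤ D) {y : X}
    (hy : Γ.dist x y = 1) : ∑ u, localMatrix Γ x 1 y u = aNum p 1 + 1 := by
  classical
  have hclique : (Finset.univ.filter fun u => Γ.dist x u = 1 ∧ Γ.dist y u ≤ 1) =
      insert y (Finset.univ.filter fun u => Γ.dist x u = 1 ∧ Γ.dist y u = 1) := by
    ext u
    have := hΓ.connected.dist_eq_zero_iff (u := y) (v := u)
    simp only [Finset.mem_filter_univ, Finset.mem_insert]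
    grind
  rw [aNum, sum_localMatrix hy, hclique, Finset.card_insert_of_notMem (by simp),
    card_dist_eq_dist_eq hΓ hD hD hy, Nat.cast_add_one]

theorem sum_localMatrix_two (hΓ : Γ.IsDistanceRegularWith D p) (hD : 1 ≤ D) {y : X}
    (hy : Γ.dist x y = 1) : ∑ u, localMatrix Γ x 2 y u = valency p := by
  rw [sum_localMatrix hy, ← card_dist_eq_one hΓ hD x]
  congr 2
  ext u
  have := dist_cases_of_dist_eq_one hΓ.connected u hy
  have := Γ.dist_comm (u := u) (v := x)
  have := Γ.dist_comm (u := u) (v := y)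
  simp only [Finset.mem_filter_univ]
  omega

theorem localMatrix_one_mul_localMatrix (hΓ : Γ.IsDistanceRegularWith D p) (hD : 1 ≤ D)
    (hconst : ∀ y u z, Γ.dist x y = 1 → Γ.dist x u = 1 → Γ.dist y u ≤ 1 →
      localMatrix Γ x n u z = localMatrix Γ x n y z) :
    localMatrix Γ x 1 * localMatrix Γ x n = ((aNum p 1 : ℂ) + 1) • localMatrix Γ x n := by
  ext y z
  have hterm : ∀ u, localMatrix Γ x 1 y u * localMatrix Γ x n u z =
      localMatrix Γ x 1 y u * localMatrix Γ x n y z := by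
    intro u
    rw [localMatrix_apply (n := 1)]
    split_ifs with h
    · rw [hconst y u z h.1 h.2.1 h.2.2]
    · rw [zero_mul, zero_mul]
  rw [Matrix.mul_apply, Finset.sum_congr rfl fun u _ => hterm u, ← Finset.sum_mul,
    Matrix.smul_apply, smul_eq_mul]
  by_cases hy : Γ.dist x y = 1
  · rw [sum_localMatrix_one hΓ hD hy]
  · rw [localMatrix_apply y z, if_neg fun h => hy h.1, mul_zero, mul_zero]

/-- The local graph is a disjoint union of cliques of size `a_1 + 1`. -/
theorem localMatrix_one_mul_self (hΓ : Γ.IsDistanceRegularWith D p)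
    (hcl : HasClassicalParameters p D b α β) (hD : 3 ≤ D) (hb : b < -1) :
    localMatrix Γ x 1 * localMatrix Γ x 1 = ((aNum p 1 : ℂ) + 1) • localMatrix Γ x 1 := by
  have htrans : ∀ y u z, Γ.dist x y = 1 → Γ.dist x u = 1 → Γ.dist x z = 1 → Γ.dist y u ≤ 1 →
      Γ.dist u z ≤ 1 → Γ.dist y z ≤ 1 := by
    intro y u z hy hu hz hyu huz
    rcases eq_or_ne y z with rfl | hne
    · rw [dist_self]
      exact zero_le_one
    rcases Nat.le_one_iff_eq_zero_or_eq_one.mp hyu with h | h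
    · rwa [hΓ.connected.dist_eq_zero_iff.mp h]
    rcases Nat.le_one_iff_eq_zero_or_eq_one.mp huz with h' | h'
    · rwa [← hΓ.connected.dist_eq_zero_iff.mp h']
    rw [dist_eq_one_iff_adj] at hy hu hz h h'
    exact (dist_eq_one_iff_adj.mpr (adj_trans_of_adj hΓ hcl hD hb hy hu hz h h' hne)).le
  refine localMatrix_one_mul_localMatrix hΓ (by omega) fun y u z hy hu hyu => ?_
  have hiff : Γ.dist x z = 1 → (Γ.dist u z ≤ 1 ↔ Γ.dist y z ≤ 1) := fun hz =>
    ⟨htrans y u z hy hu hz hyu, htrans u y z hu hy hz (Γ.dist_comm.trans_le hyu)⟩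
  simp only [localMatrix_apply, hy, hu, true_and, and_congr_right_iff.mpr hiff]

theorem localMatrix_one_mul_localMatrix_two (hΓ : Γ.IsDistanceRegularWith D p) (hD : 1 ≤ D) :
    localMatrix Γ x 1 * localMatrix Γ x 2 = ((aNum p 1 : ℂ) + 1) • localMatrix Γ x 2 := by
  refine localMatrix_one_mul_localMatrix hΓ hD fun y u z hy hu _ => ?_
  have hle : ∀ {w}, Γ.dist x w = 1 → Γ.dist x z = 1 → Γ.dist w z ≤ 2 := fun {w} hw hz => by
    have h := hΓ.connected.dist_triangle (u := w) (v := x) (w := z)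
    rwa [Γ.dist_comm (u := w) (v := x), hw, hz] at h
  simp only [localMatrix_apply, hy, hu, true_and, and_congr_right_iff.mpr fun hz =>
    iff_of_true (hle hu hz) (hle hy hz)]

theorem trace_localMatrix (hΓ : Γ.IsDistanceRegularWith D p) (hD : 1 ≤ D) (x : X) (n : ℕ) :
    (localMatrix Γ x n).trace = valency p := by
  simp only [Matrix.trace, Matrix.diag_apply, localMatrix_apply, dist_self, zero_le, and_true,
    and_self, Finset.sum_boole, card_dist_eq_one hΓ hD x]

variable [DecidableEq X]

theorem localMatrix_one (hΓ : Γ.Connected) : localMatrix Γ x 1 = Γ.dualIdempotent x 1 +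
    Γ.dualIdempotent x 1 * Γ.distMatrix 1 * Γ.dualIdempotent x 1 := by
  ext y z
  rw [← localMatrix_zero hΓ, Matrix.add_apply, localMatrix_zero hΓ, dualIdempotent,
    Matrix.mul_diagonal, Matrix.diagonal_mul, distMatrix_apply, ← dualIdempotent,
    ← localMatrix_zero hΓ, localMatrix_apply, localMatrix_apply]
  split_ifs <;> grind

theorem dualIdempotent_one_mul_localMatrix :
    Γ.dualIdempotent x 1 * localMatrix Γ x n = localMatrix Γ x n := by
  ext y z
  rw [dualIdempotent, Matrix.diagonal_mul, localMatrix_apply]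
  split_ifs <;> grind

theorem localMatrix_mul_dualIdempotent_one :
    localMatrix Γ x n * Γ.dualIdempotent x 1 = localMatrix Γ x n := by
  ext y z
  rw [dualIdempotent, Matrix.mul_diagonal, localMatrix_apply]
  split_ifs <;> grind

theorem dualIdempotent_zero_mul_adj_mul_localMatrix (hΓ : Γ.Connected)
    (hc : ∀ y, Γ.dist x y = 1 → ∑ u, localMatrix Γ x n y u = c) :
    Γ.dualIdempotent x 0 * Γ.distMatrix 1 * localMatrix Γ x n =
      c • (Γ.dualIdempotent x 0 * Γ.distMatrix 1) := by
  ext y z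
  rw [mul_assoc, Matrix.smul_apply, dualIdempotent, Matrix.diagonal_mul, Matrix.diagonal_mul]
  split_ifs with hy
  swap
  · rw [zero_mul, zero_mul, smul_zero]
  obtain rfl := hΓ.dist_eq_zero_iff.mp hy
  have hsum : (Γ.distMatrix 1 * localMatrix Γ x n) x z = ∑ u, localMatrix Γ x n z u := by
    rw [Matrix.mul_apply]
    refine Finset.sum_congr rfl fun u _ => ?_
    rw [distMatrix_apply, localMatrix_symm z u, localMatrix_apply]
    split_ifs <;> grind
  rw [hsum, one_mul, one_mul, distMatrix_apply]
  split_ifs with hz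
  · rw [hc z hz, smul_eq_mul, mul_one]
  · rw [smul_zero]
    exact Finset.sum_eq_zero fun u _ => by rw [localMatrix_apply, if_neg fun h => hz h.1]

theorem mem_localSpace_iff_localMatrix (hΓ : Γ.Connected) : v ∈ localSpace Γ x η ↔
    Γ.dualIdempotent x 1 *ᵥ v = v ∧ (Γ.dualIdempotent x 0 * Γ.distMatrix 1) *ᵥ v = 0 ∧
      localMatrix Γ x 1 *ᵥ v = (η + 1) • v := by
  rw [mem_localSpace, localMatrix_one hΓ]
  refine and_congr_right fun hv => and_congr_right fun _ => ?_
  rw [Matrix.add_mulVec, hv, add_smul, one_smul, add_comm v, add_left_inj]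

theorem localMatrix_two_mulVec (hΓ : Γ.Connected) (hv : v ∈ localSpace Γ x η) :
    localMatrix Γ x 2 *ᵥ v = 0 := by
  ext y
  rw [Matrix.mulVec, dotProduct, Pi.zero_apply]
  by_cases hy : Γ.dist x y = 1
  · rw [← sum_eq_zero_of_mem_localSpace hv]
    refine Finset.sum_congr rfl fun z _ => ?_
    by_cases hz : Γ.dist x z = 1
    · have h := hΓ.dist_triangle (u := y) (v := x) (w := z)
      rw [Γ.dist_comm (u := y) (v := x), hy, hz] at h
      rw [localMatrix_apply, if_pos ⟨hy, hz, h⟩, one_mul]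
    · rw [eq_zero_of_mem_localSpace hv hz, mul_zero]
  · refine Finset.sum_eq_zero fun z _ => ?_
    rw [localMatrix_apply, if_neg fun h => hy h.1, zero_mul]

theorem finrank_localSpace_eq_trace (hΓ : Γ.Connected) {N : Matrix X X ℂ}
    (hE1 : Γ.dualIdempotent x 1 * N = N)
    (hE0 : Γ.dualIdempotent x 0 * Γ.distMatrix 1 * N = 0)
    (hη : localMatrix Γ x 1 * N = (η + 1) • N) (hN : ∀ v ∈ localSpace Γ x η, N *ᵥ v = v) :
    (Module.finrank ℂ (localSpace Γ x η) : ℂ) = N.trace := by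
  have hproj : LinearMap.IsProj (localSpace Γ x η) (Matrix.toLin' N) :=
    ⟨fun w => (mem_localSpace_iff_localMatrix hΓ).mpr <| by
      simp only [Matrix.toLin'_apply, Matrix.mulVec_mulVec, hE1, hE0, hη, Matrix.zero_mulVec,
        Matrix.smul_mulVec, and_self], hN⟩
  rw [← hproj.trace, Matrix.trace_toLin'_eq]

theorem finrank_localSpace_neg_one (hΓ : Γ.IsDistanceRegularWith D p)
    (hcl : HasClassicalParameters p D b α β) (hD : 3 ≤ D) (hb : b < -1) (x : X) :
    (Module.finrank ℂ (localSpace Γ x (-1)) : ℂ) =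
      (valency p : ℂ) * aNum p 1 / (aNum p 1 + 1) := by
  have ha : (aNum p 1 : ℂ) + 1 ≠ 0 := Nat.cast_add_one_ne_zero _
  have hD1 : 1 ≤ D := by omega
  have hE0 := dualIdempotent_zero_mul_adj_mul_localMatrix hΓ.connected
    fun y hy => sum_localMatrix_one (x := x) hΓ hD1 hy
  have hE0' := dualIdempotent_zero_mul_adj_mul_localMatrix hΓ.connected
    fun y hy => sum_localMatrix_zero (x := x) hΓ.connected hy
  rw [finrank_localSpace_eq_trace hΓ.connected
    (N := localMatrix Γ x 0 - ((aNum p 1 : ℂ) + 1)⁻¹ • localMatrix Γ x 1)]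
  · rw [Matrix.trace_sub, Matrix.trace_smul, trace_localMatrix hΓ hD1, trace_localMatrix hΓ hD1,
      smul_eq_mul]
    field_simp
    ring
  · rw [mul_sub, mul_smul_comm, dualIdempotent_one_mul_localMatrix,
      dualIdempotent_one_mul_localMatrix]
  · rw [mul_sub, mul_smul_comm, hE0, hE0', inv_smul_smul₀ ha, one_smul, sub_self]
  · rw [mul_sub, mul_smul_comm, localMatrix_one_mul_self hΓ hcl hD hb, inv_smul_smul₀ ha,
      localMatrix_zero hΓ.connected, localMatrix_mul_dualIdempotent_one, sub_self,
      neg_add_cancel, zero_smul]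
  · intro v hv
    obtain ⟨hv1, -, hv2⟩ := (mem_localSpace_iff_localMatrix hΓ.connected).mp hv
    rw [Matrix.sub_mulVec, Matrix.smul_mulVec, localMatrix_zero hΓ.connected, hv1, hv2,
      neg_add_cancel, zero_smul, smul_zero, sub_zero]

theorem finrank_localSpace_aNum (hΓ : Γ.IsDistanceRegularWith D p)
    (hcl : HasClassicalParameters p D b α β) (hD : 3 ≤ D) (hb : b < -1) (x : X) :
    (Module.finrank ℂ (localSpace Γ x (aNum p 1)) : ℂ) = (bNum p 1 : ℂ) / (aNum p 1 + 1) := by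
  have ha : (aNum p 1 : ℂ) + 1 ≠ 0 := Nat.cast_add_one_ne_zero _
  have hD1 : 1 ≤ D := by omega
  have hk : (valency p : ℂ) = 1 + aNum p 1 + bNum p 1 := mod_cast valency_eq hΓ (by omega)
  have hk0 : (valency p : ℂ) ≠ 0 := by
    rw [Nat.cast_ne_zero, valency_eq hΓ (by omega)]
    omega
  rw [finrank_localSpace_eq_trace hΓ.connected
    (N := ((aNum p 1 : ℂ) + 1)⁻¹ • localMatrix Γ x 1 - (valency p : ℂ)⁻¹ • localMatrix Γ x 2)]
  · rw [Matrix.trace_sub, Matrix.trace_smul, Matrix.trace_smul, trace_localMatrix hΓ hD1,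
      trace_localMatrix hΓ hD1, smul_eq_mul, smul_eq_mul, inv_mul_cancel₀ hk0, hk]
    field_simp
    ring
  · rw [mul_sub, mul_smul_comm, mul_smul_comm, dualIdempotent_one_mul_localMatrix,
      dualIdempotent_one_mul_localMatrix]
  · rw [mul_sub, mul_smul_comm, mul_smul_comm,
      dualIdempotent_zero_mul_adj_mul_localMatrix hΓ.connected
        fun y hy => sum_localMatrix_one hΓ hD1 hy,
      dualIdempotent_zero_mul_adj_mul_localMatrix hΓ.connected
        fun y hy => sum_localMatrix_two hΓ hD1 hy,
      inv_smul_smul₀ ha, inv_smul_smul₀ hk0, sub_self]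
  · rw [mul_sub, mul_smul_comm, mul_smul_comm, localMatrix_one_mul_self hΓ hcl hD hb,
      localMatrix_one_mul_localMatrix_two hΓ hD1, smul_sub, smul_comm, smul_comm (valency p : ℂ)⁻¹]
  · intro v hv
    rw [Matrix.sub_mulVec, Matrix.smul_mulVec, Matrix.smul_mulVec,
      ((mem_localSpace_iff_localMatrix hΓ.connected).mp hv).2.2, inv_smul_smul₀ ha,
      localMatrix_two_mulVec hΓ.connected hv, smul_zero, sub_zero]

theorem localSpace_neg_one_ne_bot (hΓ : Γ.IsDistanceRegularWith D p)
    (hcl : HasClassicalParameters p D b α β) (hD : 3 ≤ D) (hb : b < -1) (ha : aNum p 1 ≠ 0)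
    (x : X) : localSpace Γ x (-1) ≠ ⊥ := by
  intro h
  have hk := valency_eq hΓ (by omega)
  have hrank := finrank_localSpace_neg_one hΓ hcl hD hb x
  rw [h, finrank_bot, Nat.cast_zero, eq_comm, div_eq_zero_iff,
    or_iff_left (Nat.cast_add_one_ne_zero _), mul_eq_zero, Nat.cast_eq_zero,
    Nat.cast_eq_zero] at hrank
  omega

theorem localSpace_aNum_ne_bot (hΓ : Γ.IsDistanceRegularWith D p)
    (hcl : HasClassicalParameters p D b α β) (hD : 3 ≤ D) (hb : b < -1) (x : X) :
    localSpace Γ x (aNum p 1) ≠ ⊥ := by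
  intro h
  have hb1 := bNum_pos hΓ (i := 1) (by omega)
  have hrank := finrank_localSpace_aNum hΓ hcl hD hb x
  rw [h, finrank_bot, Nat.cast_zero, eq_comm, div_eq_zero_iff,
    or_iff_left (Nat.cast_add_one_ne_zero _), Nat.cast_eq_zero] at hrank
  omega

end LocalGraph

section Classification

variable {X : Type*} [Fintype X] [DecidableEq X] {Γ : SimpleGraph X} {D : ℕ}
  {p : ℕ → ℕ → ℕ → ℕ} {b α β : ℝ} {x : X} {η η' : ℂ} {v v' : X → ℂ} {φ θ : ℕ → ℝ}
  {W : Submodule ℂ (X → ℂ)}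

theorem dualIdempotent_zero_mulVec_eq_zero_of_hasEndpoint_one (hend : Γ.HasEndpoint x W 1)
    (hv : v ∈ W) : Γ.dualIdempotent x 0 *ᵥ v = 0 := by
  have hbot : Γ.dualComponent x 0 W = ⊥ := by
    by_contra h
    exact absurd (hend.2 ⟨Nat.zero_le _, h⟩) (by omega)
  exact (Submodule.mem_bot ℂ).mp (hbot ▸ Submodule.mem_map_of_mem hv)

theorem exists_dualIdempotent_one_mulVec_eq_self (hΓ : Γ.IsDistanceRegularWith D p)
    (hW : Γ.IsTModule x W) (hend : Γ.HasEndpoint x W 1) :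
    ∃ u ∈ W, u ≠ 0 ∧ Γ.dualIdempotent x 1 *ᵥ u = u := by
  obtain ⟨_, ⟨w, hw, rfl⟩, hu0⟩ := Submodule.exists_mem_ne_zero_of_ne_bot hend.1.2
  refine ⟨_, hW _ (dualIdempotent_mem_terwilligerAlgebra hΓ x 1) w hw, hu0, ?_⟩
  rw [Matrix.mulVec_mulVec, dualIdempotent_mul_dualIdempotent, if_pos rfl]

theorem exists_mem_localSpace_of_hasEndpoint_one (hΓ : Γ.IsDistanceRegularWith D p)
    (hcl : HasClassicalParameters p D b α β) (hD : 3 ≤ D) (hb : b < -1)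
    (hW : Γ.IsTModule x W) (hend : Γ.HasEndpoint x W 1) :
    ∃ v ∈ W, v ≠ 0 ∧ (v ∈ localSpace Γ x (-1) ∨ v ∈ localSpace Γ x (aNum p 1)) := by
  have hE1 := dualIdempotent_mem_terwilligerAlgebra hΓ x 1
  have hA := distMatrix_mem_terwilligerAlgebra hΓ x 1
  have hL : localMatrix Γ x 1 ∈ Γ.terwilligerAlgebra x :=
    localMatrix_one hΓ.connected ▸ add_mem hE1 (mul_mem (mul_mem hE1 hA) hE1)
  have hE0A : ∀ w ∈ W, (Γ.dualIdempotent x 0 * Γ.distMatrix 1) *ᵥ w = 0 := fun w hw => by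
    rw [← Matrix.mulVec_mulVec]
    exact dualIdempotent_zero_mulVec_eq_zero_of_hasEndpoint_one hend (hW _ hA w hw)
  obtain ⟨u, huW, hu0, hu⟩ := exists_dualIdempotent_one_mulVec_eq_self hΓ hW hend
  by_cases heig : localMatrix Γ x 1 *ᵥ u = ((aNum p 1 : ℂ) + 1) • u
  · exact ⟨u, huW, hu0, Or.inr <|
      (mem_localSpace_iff_localMatrix hΓ.connected).mpr ⟨hu, hE0A u huW, heig⟩⟩
  · have hvW : localMatrix Γ x 1 *ᵥ u - ((aNum p 1 : ℂ) + 1) • u ∈ W :=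
      sub_mem (hW _ hL u huW) (Submodule.smul_mem _ _ huW)
    refine ⟨_, hvW, sub_ne_zero.mpr heig, Or.inl <|
      (mem_localSpace_iff_localMatrix hΓ.connected).mpr ⟨?_, hE0A _ hvW, ?_⟩⟩
    · rw [Matrix.mulVec_sub, Matrix.mulVec_mulVec, dualIdempotent_one_mul_localMatrix,
        Matrix.mulVec_smul, hu]
    · rw [Matrix.mulVec_sub, Matrix.mulVec_mulVec, localMatrix_one_mul_self hΓ hcl hD hb,
        Matrix.mulVec_smul, Matrix.smul_mulVec, sub_self, neg_add_cancel, zero_smul]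

theorem HasDualFlag.not_tModuleIso_cyclicModule (hφ : HasDualFlag Γ D φ θ)
    (hΓ : Γ.IsDistanceRegularWith D p) (hv : v ∈ localSpace Γ x η) (hv0 : v ≠ 0)
    (hv' : v' ∈ localSpace Γ x η') (hv0' : v' ≠ 0) (hη : η ≠ η') :
    ¬ Γ.TModuleIso x (cyclicModule Γ x v) (cyclicModule Γ x v') := by
  intro hiso
  obtain ⟨w, hwW, hw, hw0⟩ := exists_mem_localSpace_of_tModuleIso hΓ hiso
    (self_mem_cyclicModule v) hv hv0
  have h := (hφ.hasLocalEigenvalue_cyclicModule hΓ hv' hv0').2 w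
    ⟨w, hwW, (mem_localSpace.mp hw).1⟩
  rw [(mem_localSpace.mp hw).2.2] at h
  exact hη (smul_left_injective ℂ hw0 h)

end Classification

end DistanceRegular

open DistanceRegular in
theorem theorem13p4_general {X : Type*} [Fintype X] [DecidableEq X] (Γ : SimpleGraph X)
    (D : ℕ) (p : ℕ → ℕ → ℕ → ℕ) (b α β : ℝ)
    (hΓ : Γ.IsDistanceRegularWith D p)
    (hcl : SimpleGraph.HasClassicalParameters p D b α β)
    (hD : 3 ≤ D) (hb : b < -1)
    (ha : SimpleGraph.aNum p 1 ≠ 0)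
    (x : X) :
    ∃ W₁ W₂ : Submodule ℂ (X → ℂ),
      (Γ.IsIrreducibleTModule x W₁ ∧ Γ.HasEndpoint x W₁ 1) ∧
      (Γ.IsIrreducibleTModule x W₂ ∧ Γ.HasEndpoint x W₂ 1) ∧
      ¬ Γ.TModuleIso x W₁ W₂ ∧
      (∀ W : Submodule ℂ (X → ℂ), Γ.IsIrreducibleTModule x W → Γ.HasEndpoint x W 1 →
        Γ.TModuleIso x W W₁ ∨ Γ.TModuleIso x W W₂) ∧
      Γ.HasLocalEigenvalue x W₁ (-1) ∧
      (∃ m₁ : ℕ, Γ.AppearsWithMultiplicity x W₁ m₁ ∧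
        (m₁ : ℚ) = (SimpleGraph.valency p : ℚ) * (SimpleGraph.aNum p 1 : ℚ) /
          ((SimpleGraph.aNum p 1 : ℚ) + 1)) ∧
      Γ.HasLocalEigenvalue x W₂ (SimpleGraph.aNum p 1 : ℂ) ∧
      (∃ m₂ : ℕ, Γ.AppearsWithMultiplicity x W₂ m₂ ∧
        (m₂ : ℚ) = (SimpleGraph.bNum p 1 : ℚ) / ((SimpleGraph.aNum p 1 : ℚ) + 1)) := by
  have hb1 : 1 < |b| := lt_abs.mpr (Or.inr (by linarith))
  obtain ⟨θ, hφ⟩ := exists_hasDualFlag hΓ hcl (by omega) (by linarith) hb1.ne'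
  obtain ⟨v₁, hv₁, h₁⟩ :=
    Submodule.exists_mem_ne_zero_of_ne_bot (localSpace_neg_one_ne_bot hΓ hcl hD hb ha x)
  obtain ⟨v₂, hv₂, h₂⟩ :=
    Submodule.exists_mem_ne_zero_of_ne_bot (localSpace_aNum_ne_bot hΓ hcl hD hb x)
  have hη : (-1 : ℂ) ≠ SimpleGraph.aNum p 1 := fun h =>
    Nat.cast_add_one_ne_zero (SimpleGraph.aNum p 1) (by rw [← h, neg_add_cancel])
  refine ⟨cyclicModule Γ x v₁, cyclicModule Γ x v₂,
    ⟨hφ.isIrreducible_cyclicModule hΓ hv₁ h₁, hφ.hasEndpoint_cyclicModule hΓ (by omega) hv₁ h₁⟩,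
    ⟨hφ.isIrreducible_cyclicModule hΓ hv₂ h₂, hφ.hasEndpoint_cyclicModule hΓ (by omega) hv₂ h₂⟩,
    hφ.not_tModuleIso_cyclicModule hΓ hv₁ h₁ hv₂ h₂ hη, fun W hW hend => ?_,
    hφ.hasLocalEigenvalue_cyclicModule hΓ hv₁ h₁,
    ⟨_, hφ.appearsWithMultiplicity_cyclicModule hΓ hv₁ h₁, Rat.cast_injective (α := ℂ) ?_⟩,
    hφ.hasLocalEigenvalue_cyclicModule hΓ hv₂ h₂,
    ⟨_, hφ.appearsWithMultiplicity_cyclicModule hΓ hv₂ h₂, Rat.cast_injective (α := ℂ) ?_⟩⟩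
  · obtain ⟨v, hvW, hv0, hv⟩ := exists_mem_localSpace_of_hasEndpoint_one hΓ hcl hD hb hW.1 hend
    rw [eq_cyclicModule_of_isIrreducible hW hvW hv0]
    exact hv.imp (hφ.tModuleIso_cyclicModule hΓ · hv0 hv₁ h₁)
      (hφ.tModuleIso_cyclicModule hΓ · hv0 hv₂ h₂)
  · push_cast
    exact finrank_localSpace_neg_one hΓ hcl hD hb x
  · push_cast
    exact finrank_localSpace_aNum hΓ hcl hD hb x

theorem theorem13p4 {X : Type*} [Fintype X] [DecidableEq X] (Γ : SimpleGraph X)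
    (D : ℕ) (p : ℕ → ℕ → ℕ → ℕ) (b α β : ℝ)
    (hΓ : Γ.IsDistanceRegularWith D p)
    (hcl : SimpleGraph.HasClassicalParameters p D b α β)
    (hD : 3 ≤ D) (hb : b < -1)
    (ha : SimpleGraph.aNum p 1 ≠ 0)
    (hnp : ¬ Γ.IsNearPolygon D p)
    (x : X) :
    ∃ W₁ W₂ : Submodule ℂ (X → ℂ),
      (Γ.IsIrreducibleTModule x W₁ ∧ Γ.HasEndpoint x W₁ 1) ∧
      (Γ.IsIrreducibleTModule x W₂ ∧ Γ.HasEndpoint x W₂ 1) ∧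
      ¬ Γ.TModuleIso x W₁ W₂ ∧
      (∀ W : Submodule ℂ (X → ℂ), Γ.IsIrreducibleTModule x W → Γ.HasEndpoint x W 1 →
        Γ.TModuleIso x W W₁ ∨ Γ.TModuleIso x W W₂) ∧
      Γ.HasLocalEigenvalue x W₁ (-1) ∧
      (∃ m₁ : ℕ, Γ.AppearsWithMultiplicity x W₁ m₁ ∧
        (m₁ : ℚ) = (SimpleGraph.valency p : ℚ) * (SimpleGraph.aNum p 1 : ℚ) /
          ((SimpleGraph.aNum p 1 : ℚ) + 1)) ∧
      Γ.HasLocalEigenvalue x W₂ (SimpleGraph.aNum p 1 : ℂ) ∧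
      (∃ m₂ : ℕ, Γ.AppearsWithMultiplicity x W₂ m₂ ∧
        (m₂ : ℚ) = (SimpleGraph.bNum p 1 : ℚ) / ((SimpleGraph.aNum p 1 : ℚ) + 1)) :=
  theorem13p4_general Γ D p b α β hΓ hcl hD hb ha x
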